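/- Let $G$ be a finite group acting linearly on a finite-dimensional complex vector space $V$ with basis $v_1,\dots,v_n$, and let $\mathbf q=(q_{ij})$ be nonzero complex scalars with $q_{ii}=1$ and $q_{ji}=q_{ij}^{-1}$. Put $$S_{\mathbf q}(V)=\mathbb C\langle v_1,\dots,v_n\mid v_iv_j=q_{ij}v_jv_i\rangle,\qquad \textstyle\bigwedge_{\mathbf q}(V)=\mathbb C\langle v_1,\dots,v_n\mid v_iv_j=-q_{ij}v_jv_i\rangle ,$$ (relations for all $i,j$), and assume that the action of $G$ on $V$ extends to actions by algebra automorphisms on both $A=S_{\mathbf q}(V)$ and $\bigwedge_{\mathbf q}(V)$. The skew group algebra $A\rtimes G$ (product $(ag)(bh)=a({}^gb)\,gh$) is graded with $V$ in degree $1$ and $G$ in degree $0$. For a bilinear map $\kappa:V\times V\to\mathbb C G$ with $\kappa(v_i,v_j)=-q_{ij}\kappa(v_j,v_i)$ for all $i,j$, let $\mathcal H_{\mathbf q,\kappa}=T(V)\rtimes G/(v_iv_j-q_{ij}v_jv_i-\kappa(v_i,v_j)\mid 1\le i,j\le n)$, filtered with $V$ in degree $1$ and $G$ in degree $0$. It is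 called a quantum Drinfeld Hecke algebra if its associated graded algebra is isomorphic to $S_{\mathbf q}(V)\rtimes G$, by an isomorphism of graded algebras taking the symbols of $v\in V$ and $g\in G$ to $v$ and $g$. A constant Hochschild 2-cocycle on $A\rtimes G$ is a bilinear map $\mu:(A\rtimes G)\times(A\rtimes G)\to A\rtimes G$ that is homogeneous of degree $-2$ and satisfies $\mu(r,s)u+\mu(rs,u)=\mu(r,su)+r\mu(s,u)$ for all $r,s,u$. In terms of the quantum Koszul complex, whose differential is $$d_m(1\otimes1\otimes v_{j_1}\wedge\dots\wedge v_{j_m})=\sum_{i=1}^m(-1)^{i+1}\Big[\Big(\prod_{s=1}^iq_{j_sj_i}\Big)v_{j_i}\otimes1-\Big(\prod_{s=i}^mq_{j_ij_s}\Big)1\otimes v_{j_i}\Big]\otimes v_{j_1}\wedge\dots\wedge\widehat{v_{j_i}}\wedge\dots\wedge v_{j_m}$$ for $j_1<\dots<j_m$, it is a linear map $\alpha:\bigwedge^2_{\mathbf q}(V)\to\mathbb CG\subset A\rtimes G$ that is $G$-invariant, i.e. $\alpha({}^hw)=h\,\alpha(w)\,h^{-1}$ for all $h\in G$ and $w\in\bigwedge^2_{\mathbf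 q}(V)$, and satisfies $d_3^*\alpha=0$, i.e. the $A$-bimodule extension $(a\otimes a')\otimes w\mapsto a\,\alpha(w)\,a'$ of $\alpha$ vanishes on the image of $d_3$. Then every constant Hochschild 2-cocycle gives rise to a quantum Drinfeld Hecke algebra, in both descriptions: 1. For every constant Hochschild 2-cocycle $\mu$ on $A\rtimes G$, the formula $\kappa(v_i,v_j)=\mu(v_i,v_j)-q_{ij}\,\mu(v_j,v_i)$ for all $i,j$ defines a bilinear map $\kappa:V\times V\to\mathbb CG$ with $\kappa(v_i,v_j)=-q_{ij}\kappa(v_j,v_i)$, and $\mathcal H_{\mathbf q,\kappa}$ is a quantum Drinfeld Hecke algebra. 2. For every $G$-invariant $\alpha:\bigwedge^2_{\mathbf q}(V)\to\mathbb CG$ with $d_3^*\alpha=0$, the formula $\kappa(v_i,v_j)=\alpha(v_i\wedge v_j)$ for all $i,j$ defines a bilinear map $\kappa:V\times V\to\mathbb CG$ with $\kappa(v_i,v_j)=-q_{ij}\kappa(v_j,v_i)$, and $\mathcal H_{\mathbf q,\kappa}$ is a quantum Drinfeld Hecke algebra. -/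

import Mathlib

open scoped TensorProduct DirectSum

noncomputable section

namespace QDHA

/-! ### Associated graded algebra of an increasing filtration -/

section AssociatedGraded

variable {H : Type*} [Ring H] [Algebra ℂ H]

/-- The part of the filtration strictly below degree `d`: the sum of `F e` over `e < d`
(so it is `⊥` for `d = 0`). -/
def filtBelow (F : ℕ → Submodule ℂ H) (d : ℕ) : Submodule ℂ H :=
  ⨆ (e : ℕ) (_ : e < d), F e

/-- The graded piece `F_d / F_{d-1}`. -/
def GrPiece (F : ℕ → Submodule ℂ H) (d : ℕ) : Type _ :=
  (F d) ⧸ (filtBelow F d).comap (F d).subtype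

instance instGrAddCommGroup (F : ℕ → Submodule ℂ H) (d : ℕ) : AddCommGroup (GrPiece F d) :=
  inferInstanceAs (AddCommGroup ((F d) ⧸ (filtBelow F d).comap (F d).subtype))

instance instGrModule (F : ℕ → Submodule ℂ H) (d : ℕ) : Module ℂ (GrPiece F d) :=
  inferInstanceAs (Module ℂ ((F d) ⧸ (filtBelow F d).comap (F d).subtype))

/-- The class of `x ∈ F_d` in `F_d / F_{d-1}`. -/
def grMk (F : ℕ → Submodule ℂ H) (d : ℕ) : F d →ₗ[ℂ] GrPiece F d :=
  Submodule.mkQ ((filtBelow F d).comap (F d).subtype)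

variable (F : ℕ → Submodule ℂ H)

theorem grMk_surjective (d : ℕ) : Function.Surjective (grMk F d) :=
  Submodule.mkQ_surjective _

theorem grMk_eq_zero {d : ℕ} (x : F d) : grMk F d x = 0 ↔ (x : H) ∈ filtBelow F d :=
  (Submodule.Quotient.mk_eq_zero ((filtBelow F d).comap (F d).subtype)).trans Iff.rfl

theorem grMk_sigma_eq {i j : ℕ} (h : i = j) {x : F i} {y : F j} (hxy : (x : H) = (y : H)) :
    GradedMonoid.mk (A := GrPiece F) i (grMk F i x) = GradedMonoid.mk j (grMk F j y) := by
  subst h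
  obtain rfl : x = y := Subtype.ext hxy
  rfl

variable [SetLike.GradedMonoid F]

theorem mul_mem_filtBelow_left {i j : ℕ} {x y : H} (hx : x ∈ filtBelow F i) (hy : y ∈ F j) :
    x * y ∈ filtBelow F (i + j) := by
  have h : filtBelow F i ≤ (filtBelow F (i + j)).comap (LinearMap.mulRight ℂ y) := by
    refine iSup₂_le fun e he z hz => ?_
    exact (le_iSup₂_of_le (e + j) (by omega) le_rfl : F (e + j) ≤ filtBelow F (i + j))
      (SetLike.GradedMul.mul_mem hz hy)
  exact h hx

theorem mul_mem_filtBelow_right {i j : ℕ} {x y : H} (hx : x ∈ F i) (hy : y ∈ filtBelow F j) :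
    x * y ∈ filtBelow F (i + j) := by
  have h : filtBelow F j ≤ (filtBelow F (i + j)).comap (LinearMap.mulLeft ℂ x) := by
    refine iSup₂_le fun e he z hz => ?_
    exact (le_iSup₂_of_le (i + e) (by omega) le_rfl : F (i + e) ≤ filtBelow F (i + j))
      (SetLike.GradedMul.mul_mem hx hz)
  exact h hy

/-- Multiplication `F_i × F_j → F_{i+j} / F_{i+j-1}`. -/
def filtMul (i j : ℕ) : F i →ₗ[ℂ] F j →ₗ[ℂ] GrPiece F (i + j) :=
  LinearMap.mk₂ ℂ
    (fun x y => grMk F (i + j) ⟨(x : H) * (y : H), SetLike.GradedMul.mul_mem x.2 y.2⟩)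
    (fun x x' y => by rw [← map_add]; congr 1; ext; simp [add_mul])
    (fun c x y => by rw [← map_smul]; congr 1; ext; simp)
    (fun x y y' => by rw [← map_add]; congr 1; ext; simp [mul_add])
    (fun c x y => by rw [← map_smul]; congr 1; ext; simp)

/-- The induced product `F_i / F_{i-1} × F_j / F_{j-1} → F_{i+j} / F_{i+j-1}`. -/
def grMul (i j : ℕ) : GrPiece F i →ₗ[ℂ] GrPiece F j →ₗ[ℂ] GrPiece F (i + j) :=
  Submodule.liftQ ((filtBelow F i).comap (F i).subtype)
    (LinearMap.flip (Submodule.liftQ ((filtBelow F j).comap (F j).subtype) (filtMul F i j).flip (by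
      intro y hy
      rw [LinearMap.mem_ker]
      refine LinearMap.ext fun x => ?_
      exact (grMk_eq_zero F _).2 (mul_mem_filtBelow_right F x.2 hy))))
    (by
      intro x hx
      rw [LinearMap.mem_ker]
      refine LinearMap.ext fun y => ?_
      obtain ⟨y, rfl⟩ := grMk_surjective F j y
      exact (grMk_eq_zero F _).2 (mul_mem_filtBelow_left F hx y.2))

theorem grMul_mk {i j : ℕ} (x : F i) (y : F j) :
    grMul F i j (grMk F i x) (grMk F j y) =
      grMk F (i + j) ⟨(x : H) * (y : H), SetLike.GradedMul.mul_mem x.2 y.2⟩ := rfl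

instance instGrGMul : GradedMonoid.GMul (GrPiece F) where
  mul {i j} x y := grMul F i j x y

instance instGrGOne : GradedMonoid.GOne (GrPiece F) where
  one := grMk F 0 ⟨1, SetLike.GradedOne.one_mem⟩

theorem gr_mul_mk {i j : ℕ} (x : F i) (y : F j) :
    GradedMonoid.mk (A := GrPiece F) i (grMk F i x) * GradedMonoid.mk j (grMk F j y) =
      GradedMonoid.mk (i + j)
        (grMk F (i + j) ⟨(x : H) * (y : H), SetLike.GradedMul.mul_mem x.2 y.2⟩) := rfl

instance instGrGRing : DirectSum.GRing (GrPiece F) where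
  one_mul := by
    rintro ⟨i, x⟩
    obtain ⟨x, rfl⟩ := grMk_surjective F i x
    exact grMk_sigma_eq F (zero_add i) (one_mul _)
  mul_one := by
    rintro ⟨i, x⟩
    obtain ⟨x, rfl⟩ := grMk_surjective F i x
    exact grMk_sigma_eq F (add_zero i) (mul_one _)
  mul_assoc := by
    rintro ⟨i, x⟩ ⟨j, y⟩ ⟨k, z⟩
    obtain ⟨x, rfl⟩ := grMk_surjective F i x
    obtain ⟨y, rfl⟩ := grMk_surjective F j y
    obtain ⟨z, rfl⟩ := grMk_surjective F k z
    exact grMk_sigma_eq F (add_assoc i j k) (mul_assoc _ _ _)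
  mul_zero x := map_zero _
  zero_mul y := by simp [GradedMonoid.GMul.mul]
  mul_add x y z := map_add _ _ _
  add_mul x y z := by simp [GradedMonoid.GMul.mul]
  natCast m := m • GradedMonoid.GOne.one
  natCast_zero := zero_smul _ _
  natCast_succ m := succ_nsmul _ _
  intCast m := m • GradedMonoid.GOne.one
  intCast_ofNat m := natCast_zsmul _ _
  intCast_negSucc_ofNat m := negSucc_zsmul _ _

instance instGrGAlgebra : DirectSum.GAlgebra ℂ (GrPiece F) where
  toFun := (LinearMap.toSpanSingleton ℂ (GrPiece F 0) GradedMonoid.GOne.one).toAddMonoidHom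
  map_one := one_smul ℂ (GradedMonoid.GOne.one : GrPiece F 0)
  map_mul r s := grMk_sigma_eq F (x := (r * s) • ⟨1, SetLike.GradedOne.one_mem⟩)
    (y := ⟨(r • (1 : H)) * (s • (1 : H)), _⟩) (add_zero 0).symm (by simp [smul_smul, mul_comm])
  commutes := by
    rintro r ⟨i, x⟩
    obtain ⟨x, rfl⟩ := grMk_surjective F i x
    exact grMk_sigma_eq F (x := ⟨(r • (1 : H)) * (x : H), _⟩)
      (y := ⟨(x : H) * (r • (1 : H)), _⟩) (by omega) (by simp)
  smul_def := by
    rintro r ⟨i, x⟩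
    obtain ⟨x, rfl⟩ := grMk_surjective F i x
    exact grMk_sigma_eq F (x := r • x)
      (y := ⟨(r • (1 : H)) * (x : H), _⟩) (zero_add i).symm (by simp)

/-- The associated graded algebra `⨁_d F_d / F_{d-1}`, with the product induced from `H`. -/
abbrev Gr : Type _ := ⨁ d, GrPiece F d

/-- The symbol in `Gr F` of an element of `F_d`. -/
def symbol (d : ℕ) (x : F d) : Gr F := DirectSum.of (GrPiece F) d (grMk F d x)


end AssociatedGraded

/-! ### Group actions on algebras generated by a representation -/

section Actions

variable {G V A : Type*} [Group G] [AddCommGroup V] [Module ℂ V] [DistribMulAction G V]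
  [Ring A] [Algebra ℂ A] [MulSemiringAction G A]

/-- The action of `G` on the algebra `A` by automorphisms extends the linear action of `G` on `V`
along the linear map `ι : V → A`. -/
class ExtendsAction (G : Type*) {V A : Type*} [Group G] [AddCommGroup V] [Module ℂ V]
    [DistribMulAction G V] [Ring A] [Algebra ℂ A] [MulSemiringAction G A]
    (ι : V →ₗ[ℂ] A) : Prop where
  smul_ι : ∀ (g : G) (v : V), g • ι v = ι (g • v)

/-- For an algebra generated by `ι : V → A` in degree one: the degree `d` part, spanned by the
products of `d` elements of `V`. -/
def degPart (ι : V →ₗ[ℂ] A) (d : ℕ) : Submodule ℂ A := (LinearMap.range ι) ^ d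

theorem smul_mem_degPart [SMulCommClass G ℂ A] (ι : V →ₗ[ℂ] A) [ExtendsAction G ι]
    (d : ℕ) (g : G) {x : A} (hx : x ∈ degPart ι d) : g • x ∈ degPart ι d := by
  have h1 : (LinearMap.range ι).map (MulSemiringAction.toAlgHom ℂ A g).toLinearMap
      ≤ LinearMap.range ι := by
    rintro _ ⟨_, ⟨v, rfl⟩, rfl⟩
    exact ⟨g • v, (ExtendsAction.smul_ι g v).symm⟩
  have h2 : (degPart ι d).map (MulSemiringAction.toAlgHom ℂ A g).toLinearMap
      ≤ degPart ι d := by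
    rw [degPart, Submodule.map_pow]
    exact pow_le_pow_left' h1 d
  exact h2 ⟨x, hx, rfl⟩

/-- The skew group algebra `A ⋊ G`: the free left `A`-module on `G`, with
`(a g) (b h) = a (g • b) (g h)`. The element `a g` is `SkewMonoidAlgebra.single g a`. -/
abbrev Skew (A G : Type*) [Ring A] := SkewMonoidAlgebra A G

/-- The inclusion `ℂ G → A ⋊ G`. -/
def groupIncl (A G : Type*) [Group G] [Ring A] [Algebra ℂ A] [MulSemiringAction G A]
    [SMulCommClass G ℂ A] : MonoidAlgebra ℂ G →ₐ[ℂ] Skew A G :=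
  MonoidAlgebra.lift ℂ (Skew A G) G (SkewMonoidAlgebra.of A G)

/-- The inclusion `A → A ⋊ G`, `a ↦ a 1`. -/
def algIncl (A G : Type*) [Group G] [Ring A] [Algebra ℂ A] [MulSemiringAction G A]
    [SMulCommClass G ℂ A] : A →ₐ[ℂ] Skew A G :=
  { SkewMonoidAlgebra.singleOneRingHom with commutes' := fun _ => rfl }

/-- The degree `d` part of `A ⋊ G`, where elements of `V` have degree one and elements of `G`
degree zero. -/
def skewPart (G : Type*) {V A : Type*} [AddCommGroup V] [Module ℂ V] [Ring A] [Algebra ℂ A]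
    (ι : V →ₗ[ℂ] A) (d : ℕ) : Submodule ℂ (Skew A G) where
  carrier := {x | ∀ g, x.coeff g ∈ degPart ι d}
  add_mem' hx hy g := by simpa using add_mem (hx g) (hy g)
  zero_mem' g := by simp
  smul_mem' c x hx g := by simpa using Submodule.smul_mem _ c (hx g)

theorem single_mem_skewPart {G V A : Type*} [AddCommGroup V] [Module ℂ V] [Ring A] [Algebra ℂ A]
    (ι : V →ₗ[ℂ] A) {d : ℕ} (g : G) {a : A} (ha : a ∈ degPart ι d) :
    (SkewMonoidAlgebra.single g a : Skew A G) ∈ skewPart G ι d := by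
  classical
  intro h
  rw [SkewMonoidAlgebra.coeff_single_apply]
  split_ifs
  · exact ha
  · exact zero_mem _

theorem skewPart_mul_mem [SMulCommClass G ℂ A] (ι : V →ₗ[ℂ] A) [ExtendsAction G ι] {i j : ℕ}
    {x y : Skew A G} (hx : x ∈ skewPart G ι i) (hy : y ∈ skewPart G ι j) :
    x * y ∈ skewPart G ι (i + j) := by
  intro g
  rw [SkewMonoidAlgebra.coeff_mul_left, SkewMonoidAlgebra.sum_def']
  refine Submodule.sum_mem _ fun h _ => ?_
  have := Submodule.mul_mem_mul (hx h) (smul_mem_degPart ι j h (hy (h⁻¹ * g)))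
  rwa [degPart, degPart, ← pow_add] at this

end Actions

/-! ### The action of `G` on the tensor algebra -/

section TensorAction

variable {G V : Type*} [Group G] [AddCommGroup V] [Module ℂ V] [DistribMulAction G V]
  [SMulCommClass G ℂ V]

/-- The algebra endomorphism of `T(V)` extending the action of `g` on `V`. -/
def tensorMap (g : G) : TensorAlgebra ℂ V →ₐ[ℂ] TensorAlgebra ℂ V :=
  TensorAlgebra.lift ℂ ((TensorAlgebra.ι ℂ).comp (DistribSMul.toLinearMap ℂ V g))

theorem tensorMap_ι (g : G) (v : V) :
    tensorMap g (TensorAlgebra.ι ℂ v) = TensorAlgebra.ι ℂ (g • v) := by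
  simp [tensorMap]

instance instTensorAction : MulSemiringAction G (TensorAlgebra ℂ V) where
  smul g x := tensorMap g x
  one_smul x := by
    have : tensorMap (1 : G) = AlgHom.id ℂ (TensorAlgebra ℂ V) := by
      ext v; simp [tensorMap_ι]
    exact DFunLike.congr_fun this x
  mul_smul g h x := by
    have : tensorMap (g * h) = (tensorMap g).comp (tensorMap (V := V) h) := by
      ext v; simp [tensorMap_ι, mul_smul]
    exact DFunLike.congr_fun this x
  smul_zero g := map_zero (tensorMap g)
  smul_add g := map_add (tensorMap g)
  smul_one g := map_one (tensorMap g)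
  smul_mul g := map_mul (tensorMap g)

instance instTensorSMulComm : SMulCommClass G ℂ (TensorAlgebra ℂ V) where
  smul_comm g c x := map_smul (tensorMap g) c x

instance instTensorExtends : ExtendsAction G (TensorAlgebra.ι ℂ : V →ₗ[ℂ] TensorAlgebra ℂ V) where
  smul_ι := tensorMap_ι

end TensorAction

/-! ### Quantum symmetric and quantum exterior algebras -/

section Quantum

variable {n : ℕ} {V : Type*} [AddCommGroup V] [Module ℂ V]

/-- A tuple of nonzero scalars with `q_ii = 1` and `q_ji = q_ij⁻¹`. -/
structure IsQuantumTuple (q : Fin n → Fin n → ℂ) : Prop where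
  ne_zero : ∀ i j, q i j ≠ 0
  diag : ∀ i, q i i = 1
  inv : ∀ i j, q j i = (q i j)⁻¹

/-- The relations `v_i v_j = q_ij v_j v_i`. -/
inductive SymRel (q : Fin n → Fin n → ℂ) (b : Module.Basis (Fin n) ℂ V) :
    TensorAlgebra ℂ V → TensorAlgebra ℂ V → Prop
  | rel (i j : Fin n) :
      SymRel q b (TensorAlgebra.ι ℂ (b i) * TensorAlgebra.ι ℂ (b j))
        (q i j • (TensorAlgebra.ι ℂ (b j) * TensorAlgebra.ι ℂ (b i)))

/-- The quantum symmetric algebra `S_q(V)`. -/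
def QuantumSym (q : Fin n → Fin n → ℂ) (b : Module.Basis (Fin n) ℂ V) : Type _ :=
  RingQuot (SymRel q b)

instance instSymRing (q : Fin n → Fin n → ℂ) (b : Module.Basis (Fin n) ℂ V) :
    Ring (QuantumSym q b) := inferInstanceAs (Ring (RingQuot (SymRel q b)))

instance instSymAlgebra (q : Fin n → Fin n → ℂ) (b : Module.Basis (Fin n) ℂ V) :
    Algebra ℂ (QuantumSym q b) := inferInstanceAs (Algebra ℂ (RingQuot (SymRel q b)))

/-- The projection `T(V) → S_q(V)`. -/
def symMk (q : Fin n → Fin n → ℂ) (b : Module.Basis (Fin n) ℂ V) :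
    TensorAlgebra ℂ V →ₐ[ℂ] QuantumSym q b := RingQuot.mkAlgHom ℂ (SymRel q b)

/-- The map `V → S_q(V)`. -/
def symι (q : Fin n → Fin n → ℂ) (b : Module.Basis (Fin n) ℂ V) : V →ₗ[ℂ] QuantumSym q b :=
  (symMk q b).toLinearMap.comp (TensorAlgebra.ι ℂ)

/-- The relations `v_i v_j = - q_ij v_j v_i`. -/
inductive ExtRel (q : Fin n → Fin n → ℂ) (b : Module.Basis (Fin n) ℂ V) :
    TensorAlgebra ℂ V → TensorAlgebra ℂ V → Prop
  | rel (i j : Fin n) :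
      ExtRel q b (TensorAlgebra.ι ℂ (b i) * TensorAlgebra.ι ℂ (b j))
        ((-q i j) • (TensorAlgebra.ι ℂ (b j) * TensorAlgebra.ι ℂ (b i)))

/-- The quantum exterior algebra `⋀_q(V)`. -/
def QuantumExt (q : Fin n → Fin n → ℂ) (b : Module.Basis (Fin n) ℂ V) : Type _ :=
  RingQuot (ExtRel q b)

instance instExtRing (q : Fin n → Fin n → ℂ) (b : Module.Basis (Fin n) ℂ V) :
    Ring (QuantumExt q b) := inferInstanceAs (Ring (RingQuot (ExtRel q b)))

instance instExtAlgebra (q : Fin n → Fin n → ℂ) (b : Module.Basis (Fin n) ℂ V) :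
    Algebra ℂ (QuantumExt q b) := inferInstanceAs (Algebra ℂ (RingQuot (ExtRel q b)))

/-- The projection `T(V) → ⋀_q(V)`. -/
def extMk (q : Fin n → Fin n → ℂ) (b : Module.Basis (Fin n) ℂ V) :
    TensorAlgebra ℂ V →ₐ[ℂ] QuantumExt q b := RingQuot.mkAlgHom ℂ (ExtRel q b)

/-- The map `V → ⋀_q(V)`. -/
def extι (q : Fin n → Fin n → ℂ) (b : Module.Basis (Fin n) ℂ V) : V →ₗ[ℂ] QuantumExt q b :=
  (extMk q b).toLinearMap.comp (TensorAlgebra.ι ℂ)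

/-- The degree `m` part `⋀^m_q(V)` of the quantum exterior algebra. -/
abbrev ExtPow (q : Fin n → Fin n → ℂ) (b : Module.Basis (Fin n) ℂ V) (m : ℕ) :
    Submodule ℂ (QuantumExt q b) :=
  degPart (extι q b) m

/-- The element `v_{j_1} ∧ ⋯ ∧ v_{j_m}` of `⋀^m_q(V)`. -/
def wedge (q : Fin n → Fin n → ℂ) (b : Module.Basis (Fin n) ℂ V) {m : ℕ} (j : Fin m → Fin n) :
    ExtPow q b m :=
  ⟨(List.ofFn fun s => extι q b (b (j s))).prod, by
    induction m with
    | zero => exact ⟨1, by simp⟩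
    | succ m ih =>
      rw [List.ofFn_succ, List.prod_cons, ExtPow, degPart, pow_succ']
      exact Submodule.mul_mem_mul ⟨_, rfl⟩ (ih fun s => j s.succ)⟩

end Quantum

/-! ### Quantum Drinfeld Hecke algebras -/

section Hecke

variable {n : ℕ} {G V : Type*} [Group G] [AddCommGroup V] [Module ℂ V] [DistribMulAction G V]
  [SMulCommClass G ℂ V]

/-- The condition `κ(v_i, v_j) = - q_ij κ(v_j, v_i)` on a bilinear map `κ : V × V → ℂ G`. -/
def IsQuantumSkew (q : Fin n → Fin n → ℂ) (b : Module.Basis (Fin n) ℂ V)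
    (κ : V →ₗ[ℂ] V →ₗ[ℂ] MonoidAlgebra ℂ G) : Prop :=
  ∀ i j, κ (b i) (b j) = -(q i j • κ (b j) (b i))

/-- The relations `v_i v_j - q_ij v_j v_i = κ(v_i, v_j)` in `T(V) ⋊ G`. -/
inductive HeckeRel (q : Fin n → Fin n → ℂ) (b : Module.Basis (Fin n) ℂ V)
    (κ : V →ₗ[ℂ] V →ₗ[ℂ] MonoidAlgebra ℂ G) :
    Skew (TensorAlgebra ℂ V) G → Skew (TensorAlgebra ℂ V) G → Prop
  | rel (i j : Fin n) :
      HeckeRel q b κ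
        (algIncl (TensorAlgebra ℂ V) G
          (TensorAlgebra.ι ℂ (b i) * TensorAlgebra.ι ℂ (b j)
            - q i j • (TensorAlgebra.ι ℂ (b j) * TensorAlgebra.ι ℂ (b i))))
        (groupIncl (TensorAlgebra ℂ V) G (κ (b i) (b j)))

/-- The algebra `H_{q,κ} = (T(V) ⋊ G) / (v_i v_j - q_ij v_j v_i - κ(v_i, v_j))`. -/
def Hecke (q : Fin n → Fin n → ℂ) (b : Module.Basis (Fin n) ℂ V)
    (κ : V →ₗ[ℂ] V →ₗ[ℂ] MonoidAlgebra ℂ G) : Type _ :=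
  RingQuot (HeckeRel q b κ)

instance instHeckeRing (q : Fin n → Fin n → ℂ) (b : Module.Basis (Fin n) ℂ V)
    (κ : V →ₗ[ℂ] V →ₗ[ℂ] MonoidAlgebra ℂ G) : Ring (Hecke q b κ) :=
  inferInstanceAs (Ring (RingQuot (HeckeRel q b κ)))

instance instHeckeAlgebra (q : Fin n → Fin n → ℂ) (b : Module.Basis (Fin n) ℂ V)
    (κ : V →ₗ[ℂ] V →ₗ[ℂ] MonoidAlgebra ℂ G) : Algebra ℂ (Hecke q b κ) :=
  inferInstanceAs (Algebra ℂ (RingQuot (HeckeRel q b κ)))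

/-- The projection `T(V) ⋊ G → H_{q,κ}`. -/
def heckeMk (q : Fin n → Fin n → ℂ) (b : Module.Basis (Fin n) ℂ V)
    (κ : V →ₗ[ℂ] V →ₗ[ℂ] MonoidAlgebra ℂ G) :
    Skew (TensorAlgebra ℂ V) G →ₐ[ℂ] Hecke q b κ :=
  RingQuot.mkAlgHom ℂ (HeckeRel q b κ)

/-- The filtration of `H_{q,κ}` with `V` in degree one and `G` in degree zero: the image of the
part of degree at most `d` of `T(V) ⋊ G`. -/
def heckeFilt (q : Fin n → Fin n → ℂ) (b : Module.Basis (Fin n) ℂ V)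
    (κ : V →ₗ[ℂ] V →ₗ[ℂ] MonoidAlgebra ℂ G) (d : ℕ) : Submodule ℂ (Hecke q b κ) :=
  (⨆ (e : ℕ) (_ : e ≤ d), skewPart G (TensorAlgebra.ι ℂ : V →ₗ[ℂ] TensorAlgebra ℂ V) e).map
    (heckeMk q b κ).toLinearMap

variable (q : Fin n → Fin n → ℂ) (b : Module.Basis (Fin n) ℂ V)
  (κ : V →ₗ[ℂ] V →ₗ[ℂ] MonoidAlgebra ℂ G)

theorem heckeMk_mem {d : ℕ} {x : Skew (TensorAlgebra ℂ V) G}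
    (hx : x ∈ skewPart G (TensorAlgebra.ι ℂ : V →ₗ[ℂ] TensorAlgebra ℂ V) d) :
    heckeMk q b κ x ∈ heckeFilt q b κ d := by
  refine Submodule.mem_map_of_mem (f := (heckeMk q b κ).toLinearMap) ?_
  exact Submodule.mem_iSup_of_mem d (Submodule.mem_iSup_of_mem le_rfl hx)

instance instHeckeFilt : SetLike.GradedMonoid (heckeFilt q b κ) where
  one_mem := by
    rw [← map_one (heckeMk q b κ)]
    exact heckeMk_mem q b κ (single_mem_skewPart _ 1 (by simp [degPart]))
  mul_mem := by
    rintro i j _ _ ⟨x, hx, rfl⟩ ⟨y, hy, rfl⟩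
    refine ⟨x * y, ?_, map_mul (heckeMk q b κ) x y⟩
    set P := skewPart G (TensorAlgebra.ι ℂ : V →ₗ[ℂ] TensorAlgebra ℂ V)
    have key : (⨆ (e : ℕ) (_ : e ≤ i), P e) * (⨆ (e : ℕ) (_ : e ≤ j), P e)
        ≤ ⨆ (e : ℕ) (_ : e ≤ i + j), P e := by
      simp only [Submodule.iSup_mul, Submodule.mul_iSup]
      refine iSup₂_le fun f hf => iSup₂_le fun e he => ?_
      refine le_iSup₂_of_le (e + f) (by omega) ?_
      exact Submodule.mul_le.2 fun a ha c hc => skewPart_mul_mem _ ha hc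
    exact key (Submodule.mul_mem_mul hx hy)

/-- The group element `g`, as an element of filtration degree zero in `H_{q,κ}`. -/
def heckeG (g : G) : heckeFilt q b κ 0 :=
  ⟨heckeMk q b κ (SkewMonoidAlgebra.single g 1),
    heckeMk_mem q b κ (single_mem_skewPart _ g (by simp [degPart]))⟩

/-- The vector `v`, as an element of filtration degree one in `H_{q,κ}`. -/
def heckeV (v : V) : heckeFilt q b κ 1 :=
  ⟨heckeMk q b κ (SkewMonoidAlgebra.single 1 (TensorAlgebra.ι ℂ v)),
    heckeMk_mem q b κ (single_mem_skewPart _ 1 (by simp [degPart]))⟩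

/-- `H_{q,κ}` is a quantum Drinfeld Hecke algebra: its associated graded algebra is isomorphic to
`S_q(V) ⋊ G`, by an isomorphism of algebras that takes the symbols of `v ∈ V` (degree one) and
`g ∈ G` (degree zero) to `v` and `g`, and is therefore an isomorphism of graded algebras. -/
def IsQuantumDrinfeldHecke [MulSemiringAction G (QuantumSym q b)]
    [SMulCommClass G ℂ (QuantumSym q b)] : Prop :=
  ∃ e : Gr (heckeFilt q b κ) ≃ₐ[ℂ] Skew (QuantumSym q b) G,
    (∀ v, e (symbol _ 1 (heckeV q b κ v)) = SkewMonoidAlgebra.single 1 (symι q b v)) ∧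
    (∀ g, e (symbol _ 0 (heckeG q b κ g)) = SkewMonoidAlgebra.single g 1)

end Hecke

/-! ### Constant Hochschild 2-cocycles -/

section Cocycles

variable {n : ℕ} {G V : Type*} [Group G] [AddCommGroup V] [Module ℂ V]

/-- A bilinear map `μ : R × R → R` is a Hochschild 2-cocycle. -/
def IsHochschildTwoCocycle {R : Type*} [Ring R] [Algebra ℂ R] (μ : R →ₗ[ℂ] R →ₗ[ℂ] R) : Prop :=
  ∀ r s u, μ r s * u + μ (r * s) u = μ r (s * u) + r * μ s u

/-- A bilinear map on `A ⋊ G` is homogeneous of degree `-2`: it maps degrees `i` and `j` to degree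
`i + j - 2`, and to zero if this number is negative. -/
def HasDegreeNegTwo {A : Type*} [Ring A] [Algebra ℂ A] (ι : V →ₗ[ℂ] A)
    (μ : Skew A G →ₗ[ℂ] Skew A G →ₗ[ℂ] Skew A G) : Prop :=
  ∀ i j, ∀ x ∈ skewPart G ι i, ∀ y ∈ skewPart G ι j,
    (i + j < 2 → μ x y = 0) ∧ (2 ≤ i + j → μ x y ∈ skewPart G ι (i + j - 2))

variable (q : Fin n → Fin n → ℂ) (b : Module.Basis (Fin n) ℂ V)

/-- The differential `d_{m+1}` of the quantum Koszul resolution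
`⋯ → A^e ⊗ ⋀^{m+1}_q(V) → A^e ⊗ ⋀^m_q(V) → ⋯` of `A = S_q(V)`, where `A^e = A ⊗ A^op`, evaluated
on the generator `1 ⊗ 1 ⊗ v_{j_1} ∧ ⋯ ∧ v_{j_{m+1}}` with `j_1 < ⋯ < j_{m+1}` (indices of `j` start
at zero here). -/
def koszulD {m : ℕ} (j : Fin (m + 1) → Fin n) :
    (QuantumSym q b ⊗[ℂ] (QuantumSym q b)ᵐᵒᵖ) ⊗[ℂ] ExtPow q b m :=
  ∑ i : Fin (m + 1), (-1 : ℂ) ^ (i : ℕ) •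
    (((∏ s ∈ Finset.Iic i, q (j s) (j i)) • (symι q b (b (j i)) ⊗ₜ[ℂ] MulOpposite.op 1)
      - (∏ s ∈ Finset.Ici i, q (j i) (j s)) • (1 ⊗ₜ[ℂ] MulOpposite.op (symι q b (b (j i)))))
      ⊗ₜ[ℂ] wedge q b (j ∘ i.succAbove))

variable [MulSemiringAction G (QuantumSym q b)] [SMulCommClass G ℂ (QuantumSym q b)]

variable {q b} in
/-- The `A^e`-linear map `A^e ⊗ ⋀^m_q(V) → A ⋊ G` with `(a ⊗ a') ⊗ w ↦ a α(w) a'` that corresponds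
to a linear map `α : ⋀^m_q(V) → A ⋊ G`, for `A = S_q(V)`. -/
def koszulExtend {m : ℕ} (α : ExtPow q b m →ₗ[ℂ] Skew (QuantumSym q b) G) :
    (QuantumSym q b ⊗[ℂ] (QuantumSym q b)ᵐᵒᵖ) ⊗[ℂ] ExtPow q b m →ₗ[ℂ]
      Skew (QuantumSym q b) G :=
  TensorProduct.lift
    (((AlgHom.mulLeftRight ℂ (Skew (QuantumSym q b) G)).toLinearMap.comp
      (Algebra.TensorProduct.map (algIncl (QuantumSym q b) G)
        (AlgHom.op (algIncl (QuantumSym q b) G))).toLinearMap).compl₂ α)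

variable {q b} in
theorem koszulExtend_tmul {m : ℕ} (α : ExtPow q b m →ₗ[ℂ] Skew (QuantumSym q b) G)
    (a a' : QuantumSym q b) (w : ExtPow q b m) :
    koszulExtend α ((a ⊗ₜ MulOpposite.op a') ⊗ₜ w) =
      algIncl _ G a * α w * algIncl _ G a' := by
  simp [koszulExtend]

/-- `α : ⋀^m_q(V) → A ⋊ G` is a cocycle of the quantum Koszul cochain complex
`Hom_{A^e}(A^e ⊗ ⋀^•_q(V), A ⋊ G)`: the cochain `d_{m+1}^* α = α ∘ d_{m+1}` is zero, that is, it
vanishes on all generators `1 ⊗ 1 ⊗ v_{j_1} ∧ ⋯ ∧ v_{j_{m+1}}` with `j_1 < ⋯ < j_{m+1}`. -/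
def IsKoszulCocycle {m : ℕ} (α : ExtPow q b m →ₗ[ℂ] Skew (QuantumSym q b) G) : Prop :=
  ∀ j : Fin (m + 1) → Fin n, StrictMono j → koszulExtend α (koszulD q b j) = 0

/-- `α : ⋀^m_q(V) → A ⋊ G` is `G`-invariant: `α(h • w) = h α(w) h⁻¹`. -/
def IsKoszulInvariant [DistribMulAction G V] [MulSemiringAction G (QuantumExt q b)]
    [SMulCommClass G ℂ (QuantumExt q b)] [ExtendsAction G (extι q b)]
    {m : ℕ} (α : ExtPow q b m →ₗ[ℂ] Skew (QuantumSym q b) G) : Prop :=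
  ∀ (h : G) (w : ExtPow q b m),
    α ⟨h • (w : QuantumExt q b), smul_mem_degPart (extι q b) m h w.2⟩ =
      SkewMonoidAlgebra.single h 1 * α w * SkewMonoidAlgebra.single h⁻¹ 1

/-- A constant Hochschild 2-cocycle on `S_q(V) ⋊ G`: a 2-cocycle of degree `-2`. -/
structure IsConstantCocycle
    (μ : Skew (QuantumSym q b) G →ₗ[ℂ] Skew (QuantumSym q b) G →ₗ[ℂ] Skew (QuantumSym q b) G) :
    Prop where
  cocycle : IsHochschildTwoCocycle μ
  degree : HasDegreeNegTwo (symι q b) μ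

/-- A constant Hochschild 2-cocycle on `S_q(V) ⋊ G`, written through the quantum Koszul complex:
a `G`-invariant 2-cocycle `⋀²_q(V) → S_q(V) ⋊ G` with values in `ℂ G`. -/
structure IsConstantKoszulCocycle [DistribMulAction G V] [MulSemiringAction G (QuantumExt q b)]
    [SMulCommClass G ℂ (QuantumExt q b)] [ExtendsAction G (extι q b)]
    (α : ExtPow q b 2 →ₗ[ℂ] Skew (QuantumSym q b) G) : Prop where
  cocycle : IsKoszulCocycle q b α
  invariant : IsKoszulInvariant q b α
  constant : ∀ w, α w ∈ (groupIncl (QuantumSym q b) G).range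

end Cocycles

end QDHA

end

/-! The algebra H_{q,κ} is T(V) ⋊ G with each ascent v_i v_j, i < j, rewritten as q_ij v_j v_i +
κ(v_i, v_j). Rewriting terminates, so by Bergman's diamond lemma nothing collapses once two
conditions hold. The relations must be stable under conjugation by G (`InvariantRelations`), so that
group elements can be pushed to the right. The overlap v_i v_j v_k with i < j < k must be
resolvable, which is the vanishing of the degree-one expression `jacobi`.

The diamond lemma is used in linear form (`exists_linearMap_of_confluent`): instead of a basis of
normal words, it produces linear maps that kill the ideal and are prescribed on irreducible words.
With these, an element of degree d whose image in H_{q,κ} drops in filtration already vanishes in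
S_q(V) ⋊ G (`skewSymMk_eq_zero_of_mem_filtBelow`). Hence the natural surjection from S_q(V) ⋊ G to
the associated graded algebra is injective (`isQuantumDrinfeldHecke_of_jacobi`).

Both kinds of cocycle supply the two conditions. For a Koszul cocycle, d_3^*α on v_i ∧ v_j ∧ v_k is
minus the Jacobi expression, and invariance is assumed. For a Hochschild cocycle, a signed and
q-weighted sum of the cocycle identity over the six orderings of v_i, v_j, v_k gives the Jacobi
identity. Degree -2 forces μ(g, v) = μ(v, g) = 0, and the cocycle identity with one argument in G
then gives invariance of the quantum antisymmetrization. These facts hold over S_q(V) ⋊ G; they lift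
to T(V) ⋊ G because V embeds in S_q(V) and because bilinear maps respecting the relations factor
through degree two (`bilin_eq_of_symι_mul_eq`). -/

namespace QDHA

noncomputable section


/-! ### A linear form of the diamond lemma -/

section Diamond

variable {W K E X : Type*} [AddCommGroup E] [Module ℂ E] [AddCommGroup X] [Module ℂ X]

/-- If a family of relations `ρ k` in a based vector space has leading basis vectors `lead k` for a
well-founded relation, and any two relations with the same leading vector differ by a combination of
relations with smaller leading vectors, then a linear map that vanishes on all relations may be
prescribed freely on the basis vectors that are not leading. -/
theorem exists_linearMap_of_confluent (e : Module.Basis W ℂ E) {lt : W → W → Prop}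
    (wf : WellFounded lt) (lead : K → W) (ρ : K → E)
    (hlead : ∀ k, e (lead k) - ρ k ∈ Submodule.span ℂ (e '' {u | lt u (lead k)}))
    (conf : ∀ k k', lead k = lead k' →
      ρ k - ρ k' ∈ Submodule.span ℂ (ρ '' {l | lt (lead l) (lead k)}))
    (t : W → X) :
    ∃ L : E →ₗ[ℂ] X, (∀ k, L (ρ k) = 0) ∧ ∀ w, w ∉ Set.range lead → L (e w) = t w := by
  classical
  -- At a leading vector the value is dictated by one chosen relation, which rewrites it through
  -- smaller vectors. The inner default 0 is never met on the support, by `hlead`.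
  let N : W → X := wf.fix fun w ih =>
    if h : ∃ k, lead k = w then
      ((e.repr (e w - ρ h.choose)).sum fun u c => c • if hu : lt u w then ih u hu else 0)
    else t w
  have hN : ∀ w, N w = if h : ∃ k, lead k = w then
      ((e.repr (e w - ρ h.choose)).sum fun u c => c • if lt u w then N u else 0)
    else t w := by
    intro w
    show wf.fix _ w = _
    rw [wf.fix_eq]
    simp only [dite_eq_ite]
    rfl
  let L : E →ₗ[ℂ] X := e.constr ℂ N
  have hL : ∀ w, L (e w) = N w := fun w => e.constr_basis ℂ N w
  have hchosen : ∀ w (h : ∃ k, lead k = w), L (ρ h.choose) = 0 := by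
    intro w h
    have h1 : L (e w - ρ h.choose) = N w := by
      rw [hN, dif_pos h]
      conv_lhs => rw [← e.linearCombination_repr (e w - ρ h.choose)]
      rw [Finsupp.linearCombination_apply, map_finsuppSum]
      refine Finsupp.sum_congr fun u hu => ?_
      have hmem := hlead h.choose
      rw [h.choose_spec, e.mem_span_image] at hmem
      rw [map_smul, hL, if_pos (show lt u w from hmem hu)]
    rw [map_sub, hL] at h1
    simpa using h1
  refine ⟨L, ?_, fun w hw => ?_⟩
  -- By construction only the chosen relation is killed. Any other with the same leading vector
  -- differs from it by relations with smaller leading vectors, which vanish by induction.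
  · suffices h : ∀ w k, lead k = w → L (ρ k) = 0 from fun k => h _ k rfl
    intro w
    induction w using wf.induction with
    | _ w ih =>
      intro k hk
      have hex : ∃ k, lead k = w := ⟨k, hk⟩
      have h1 := conf k hex.choose (hk.trans hex.choose_spec.symm)
      have h2 : Submodule.span ℂ (ρ '' {l | lt (lead l) (lead k)}) ≤ LinearMap.ker L := by
        rw [Submodule.span_le]
        rintro _ ⟨l, hl, rfl⟩
        exact ih (lead l) (hk ▸ hl) l rfl
      have h3 := h2 h1
      rw [LinearMap.mem_ker, map_sub, hchosen w hex, sub_zero] at h3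
      exact h3
  · rw [hL, hN, dif_neg]
    exact fun ⟨k, hk⟩ => hw ⟨k, hk⟩

end Diamond

/-! ### Kernels of quotients by ring relations -/

/-- A subspace closed under multiplication that contains the differences of related elements
contains the kernel of the projection. -/
theorem mem_of_mkAlgHom_eq_zero {R : Type*} [Ring R] [Algebra ℂ R] {s : R → R → Prop}
    (I : Submodule ℂ R) (hs : ∀ x y, s x y → x - y ∈ I)
    (hl : ∀ x, ∀ y ∈ I, x * y ∈ I) (hr : ∀ x, ∀ y ∈ I, y * x ∈ I) {x : R}
    (hx : RingQuot.mkAlgHom ℂ s x = 0) : x ∈ I := by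
  have hrel : ∀ {x y}, RingQuot.Rel s x y → x - y ∈ I := by
    intro x y h
    induction h with
    | of h => exact hs _ _ h
    | add_left _ h => simpa using h
    | mul_left _ h => rw [← sub_mul]; exact hr _ _ h
    | mul_right _ h => rw [← mul_sub]; exact hl _ _ h
  have hx' : RingQuot.mkAlgHom ℂ s x = RingQuot.mkAlgHom ℂ s 0 := by rw [hx, map_zero]
  -- Equality in `RingQuot` is equality of classes for the equivalence generated by `RingQuot.Rel`,
  -- so membership in `I` need only be followed along generating steps.
  have hq : Quot.mk (RingQuot.Rel s) x = Quot.mk _ 0 := by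
    simpa [RingQuot.mkAlgHom_def, RingQuot.mkRingHom_def] using hx'
  have heqv : ∀ {x y}, Relation.EqvGen (RingQuot.Rel s) x y → x - y ∈ I := by
    intro x y h
    induction h with
    | rel _ _ h => exact hrel h
    | refl => simp
    | symm _ _ _ h => simpa using I.neg_mem h
    | trans _ _ _ _ _ h1 h2 => simpa using I.add_mem h1 h2
  simpa using heqv (Quot.eqvGen_exact hq)

open SkewMonoidAlgebra

/-! ### Words in skew group algebras -/

section Words

variable {n : ℕ} {G V : Type*} [AddCommGroup V] [Module ℂ V]

/-- The product in `T(V)` of the basis vectors with indices in a list. -/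
def word (b : Module.Basis (Fin n) ℂ V) (w : List (Fin n)) : TensorAlgebra ℂ V :=
  (w.map fun i => TensorAlgebra.ι ℂ (b i)).prod

variable (b : Module.Basis (Fin n) ℂ V)

@[simp] theorem word_nil : word b [] = 1 := rfl

theorem word_cons (i : Fin n) (w : List (Fin n)) :
    word b (i :: w) = TensorAlgebra.ι ℂ (b i) * word b w := by simp [word]

theorem word_append (u w : List (Fin n)) : word b (u ++ w) = word b u * word b w := by
  simp [word]

theorem tensorAlgebra_basis_apply (w : FreeMonoid (Fin n)) :
    b.tensorAlgebra w = word b w.toList := by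
  simp [Module.Basis.tensorAlgebra, FreeAlgebra.basisFreeMonoid,
    FreeAlgebra.equivMonoidAlgebraFreeMonoid, FreeMonoid.lift_apply, map_list_prod, word,
    Function.comp_def]

theorem degPart_tensor_eq_span (d : ℕ) :
    degPart (TensorAlgebra.ι ℂ : V →ₗ[ℂ] TensorAlgebra ℂ V) d =
      Submodule.span ℂ (word b '' {w | w.length = d}) := by
  induction d with
  | zero =>
    rw [degPart, pow_zero, Submodule.one_eq_span]
    congr 1
    ext x
    simp [List.length_eq_zero_iff]
  | succ d ih =>
    have h1 : LinearMap.range (TensorAlgebra.ι ℂ : V →ₗ[ℂ] TensorAlgebra ℂ V) =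
        Submodule.span ℂ (Set.range fun i => TensorAlgebra.ι ℂ (b i)) := by
      rw [LinearMap.range_eq_map, ← b.span_eq, Submodule.map_span, ← Set.range_comp]
      rfl
    rw [degPart, pow_succ', ← degPart, ih, h1, Submodule.span_mul_span]
    congr 1
    ext x
    constructor
    · rintro ⟨_, ⟨i, rfl⟩, _, ⟨w, hw, rfl⟩, rfl⟩
      exact ⟨i :: w, by simpa using hw, word_cons b i w⟩
    · rintro ⟨w, hw, rfl⟩
      cases w with
      | nil => simp at hw
      | cons i w => exact ⟨_, ⟨i, rfl⟩, _, ⟨w, by simpa using hw, rfl⟩, (word_cons b i w).symm⟩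

theorem word_mem_degPart (w : List (Fin n)) :
    word b w ∈ degPart (TensorAlgebra.ι ℂ : V →ₗ[ℂ] TensorAlgebra ℂ V) w.length := by
  rw [degPart_tensor_eq_span b]
  exact Submodule.subset_span ⟨w, rfl, rfl⟩

/-- The coefficients of an element of `A ⋊ G`, as a linear equivalence. -/
def coeffLinearEquiv (A G : Type*) [Ring A] [Algebra ℂ A] : Skew A G ≃ₗ[ℂ] (G →₀ A) :=
  { SkewMonoidAlgebra.coeffAddEquiv with map_smul' := fun c x => coeff_smul c x }

/-- The basis of `T(V) ⋊ G` that consists of the products of words and group elements. -/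
def wordBasis (G : Type*) : Module.Basis (List (Fin n) × G) ℂ (Skew (TensorAlgebra ℂ V) G) :=
  ((Finsupp.basis fun _ : G => b.tensorAlgebra).map
    (coeffLinearEquiv (TensorAlgebra ℂ V) G).symm).reindex
    ((Equiv.sigmaEquivProd G (FreeMonoid (Fin n))).trans
      ((Equiv.prodComm _ _).trans (Equiv.prodCongr FreeMonoid.toList (Equiv.refl G))))

theorem wordBasis_apply (w : List (Fin n)) (g : G) :
    wordBasis b G (w, g) = single g (word b w) := by
  simp [wordBasis, coeffLinearEquiv, tensorAlgebra_basis_apply, coeffAddEquiv, Equiv.prodCongr]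

theorem single_word_mem (w : List (Fin n)) (g : G) :
    (single g (word b w) : Skew (TensorAlgebra ℂ V) G) ∈
      skewPart G (TensorAlgebra.ι ℂ : V →ₗ[ℂ] TensorAlgebra ℂ V) w.length :=
  single_mem_skewPart _ g (word_mem_degPart b w)

theorem skewPart_tensor_eq_span (d : ℕ) :
    skewPart G (TensorAlgebra.ι ℂ : V →ₗ[ℂ] TensorAlgebra ℂ V) d =
      Submodule.span ℂ (wordBasis b G '' {w | w.1.length = d}) := by
  apply le_antisymm
  · intro x hx
    rw [← sum_single x, sum_def']
    refine Submodule.sum_mem _ fun g _ => ?_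
    have h := hx g
    rw [degPart_tensor_eq_span b] at h
    have h2 : (Submodule.span ℂ (word b '' {w | w.length = d})).map
        (lsingle (R := ℂ) (M := TensorAlgebra ℂ V) g) ≤
        Submodule.span ℂ (wordBasis b G '' {w | w.1.length = d}) := by
      rw [Submodule.map_span_le]
      rintro _ ⟨w, hw, rfl⟩
      exact Submodule.subset_span ⟨(w, g), hw, wordBasis_apply b w g⟩
    exact h2 ⟨_, h, rfl⟩
  · rw [Submodule.span_le]
    rintro _ ⟨⟨w, g⟩, rfl, rfl⟩
    rw [wordBasis_apply]
    exact single_word_mem b w g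

theorem iSup_skewPart_tensor (G : Type*) {V : Type*} [AddCommGroup V] [Module ℂ V]
    (b : Module.Basis (Fin n) ℂ V) :
    ⨆ d, skewPart G (TensorAlgebra.ι ℂ : V →ₗ[ℂ] TensorAlgebra ℂ V) d = ⊤ := by
  rw [eq_top_iff, ← (wordBasis b G).span_eq, Submodule.span_le]
  rintro _ ⟨⟨w, g⟩, rfl⟩
  rw [wordBasis_apply]
  exact Submodule.mem_iSup_of_mem _ (single_word_mem b w g)

end Words

/-! ### Relations of quantum Drinfeld Hecke algebras and normal forms -/

theorem one_mem_degPart {V A : Type*} [AddCommGroup V] [Module ℂ V] [Ring A] [Algebra ℂ A]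
    (ι : V →ₗ[ℂ] A) : (1 : A) ∈ degPart ι 0 := by
  rw [degPart, pow_zero]
  exact Submodule.mem_one.2 ⟨1, map_one _⟩

theorem groupIncl_mem_skewPart {G V A : Type*} [Group G] [AddCommGroup V] [Module ℂ V] [Ring A]
    [Algebra ℂ A] [MulSemiringAction G A] [SMulCommClass G ℂ A] (ι : V →ₗ[ℂ] A)
    (x : MonoidAlgebra ℂ G) : groupIncl A G x ∈ skewPart G ι 0 := by
  rw [groupIncl, MonoidAlgebra.lift_apply]
  refine Submodule.sum_mem _ fun g _ => Submodule.smul_mem _ _ ?_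
  rw [of_apply]
  exact single_mem_skewPart _ g (one_mem_degPart ι)

section NormalForm

variable {n : ℕ} {G V : Type*} [Group G] [AddCommGroup V] [Module ℂ V] [DistribMulAction G V]
  [SMulCommClass G ℂ V]

/-- The element `v_i v_j - q_ij v_j v_i - κ(v_i, v_j)` of `T(V) ⋊ G`. -/
def relElt (q : Fin n → Fin n → ℂ) (b : Module.Basis (Fin n) ℂ V)
    (κ : V →ₗ[ℂ] V →ₗ[ℂ] MonoidAlgebra ℂ G) (i j : Fin n) : Skew (TensorAlgebra ℂ V) G :=
  algIncl (TensorAlgebra ℂ V) G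
      (TensorAlgebra.ι ℂ (b i) * TensorAlgebra.ι ℂ (b j)
        - q i j • (TensorAlgebra.ι ℂ (b j) * TensorAlgebra.ι ℂ (b i)))
    - groupIncl (TensorAlgebra ℂ V) G (κ (b i) (b j))

/-- The Jacobi expression of three elements `v_i`, `v_j`, `v_k` of `B ⋊ G`, for an algebra `B`
generated by `ι : V → B`. -/
def jacobi {B : Type*} [Ring B] [Algebra ℂ B] [MulSemiringAction G B] [SMulCommClass G ℂ B]
    (ι : V →ₗ[ℂ] B) (q : Fin n → Fin n → ℂ) (b : Module.Basis (Fin n) ℂ V)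
    (κ : V →ₗ[ℂ] V →ₗ[ℂ] MonoidAlgebra ℂ G) (i j k : Fin n) : Skew B G :=
  groupIncl B G (κ (b i) (b j)) * algIncl B G (ι (b k))
    - algIncl B G (ι (b i)) * groupIncl B G (κ (b j) (b k))
    + q i j • (algIncl B G (ι (b j)) * groupIncl B G (κ (b i) (b k)))
    - q j k • (groupIncl B G (κ (b i) (b k)) * algIncl B G (ι (b j)))
    - (q j k * q i k) • (algIncl B G (ι (b k)) * groupIncl B G (κ (b i) (b j)))
    + (q i j * q i k) • (groupIncl B G (κ (b j) (b k)) * algIncl B G (ι (b i)))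

variable (q : Fin n → Fin n → ℂ) (b : Module.Basis (Fin n) ℂ V)
  (κ : V →ₗ[ℂ] V →ₗ[ℂ] MonoidAlgebra ℂ G)

/-- The relations are invariant under conjugation by `G`. -/
def InvariantRelations : Prop :=
  ∀ (h : G) (i j : Fin n), single h 1 * relElt q b κ i j * single h⁻¹ 1 ∈
    Submodule.span ℂ (Set.range fun p : Fin n × Fin n => relElt q b κ p.1 p.2)

variable {q b κ}

theorem single_word_mul (u w : List (Fin n)) (g : G) :
    (single 1 (word b u) * single g (word b w) : Skew (TensorAlgebra ℂ V) G) =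
      single g (word b (u ++ w)) := by
  rw [single_mul_single, one_mul, one_smul, word_append]

theorem relElt_eq (i j : Fin n) :
    relElt q b κ i j = single 1 (word b [i, j]) - q i j • single 1 (word b [j, i])
      - groupIncl (TensorAlgebra ℂ V) G (κ (b i) (b j)) := by
  rw [relElt, map_sub, map_smul]
  simp only [word_cons, word_nil, mul_one]
  rfl

/-- This is the rewriting rule: the last term is two letters shorter, since κ takes values in degree
zero. -/
theorem word_mul_relElt_mul (u w : List (Fin n)) (g : G) (i j : Fin n) :
    single 1 (word b u) * relElt q b κ i j * single g (word b w) =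
      single g (word b (u ++ i :: j :: w)) - q i j • single g (word b (u ++ j :: i :: w))
        - single 1 (word b u) * groupIncl (TensorAlgebra ℂ V) G (κ (b i) (b j)) *
          single g (word b w) := by
  rw [relElt_eq]
  simp only [mul_sub, sub_mul, mul_smul_comm, smul_mul_assoc, single_word_mul,
    List.append_assoc, List.cons_append, List.nil_append]

theorem relElt_diag (hq : IsQuantumTuple q) (hκ : IsQuantumSkew q b κ) (i : Fin n) :
    relElt q b κ i i = 0 := by
  have h : κ (b i) (b i) = 0 := by
    have h := hκ i i
    rw [hq.diag, one_smul] at h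
    have h2 : (2 : ℂ) • κ (b i) (b i) = 0 := by
      rw [two_smul]; nth_rewrite 1 [h]; exact neg_add_cancel _
    exact (smul_eq_zero.1 h2).resolve_left two_ne_zero
  rw [relElt, h, hq.diag]
  simp

/-- Together with `relElt_diag` this leaves only the relations with i < j, so rewriting rules
correspond to ascents in words. -/
theorem relElt_swap (hq : IsQuantumTuple q) (hκ : IsQuantumSkew q b κ) (i j : Fin n) :
    relElt q b κ i j = -(q i j) • relElt q b κ j i := by
  have h : q i j * q j i = 1 := by rw [hq.inv i j, mul_inv_cancel₀ (hq.ne_zero i j)]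
  rw [relElt_eq, relElt_eq, hκ i j]
  simp only [smul_sub, smul_smul, map_neg, map_smul, neg_smul, neg_mul, h, one_smul]
  abel

/-- A group element on the left is absorbed by u h r y = u (h r h⁻¹) (h y): by `hinv` the conjugate
is again a combination of relations, and h y has the same degree as y. So the ideal is spanned by
multiples whose left factor is a pure word. -/
theorem skew_mul_relElt_mul_mem (hq : IsQuantumTuple q) (hκ : IsQuantumSkew q b κ)
    (hinv : InvariantRelations q b κ) (N : Submodule ℂ (Skew (TensorAlgebra ℂ V) G)) {p s : ℕ}
    (hN : ∀ (u w : List (Fin n)) (g : G) (i j : Fin n), i < j → u.length = p → w.length = s →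
      single 1 (word b u) * relElt q b κ i j * single g (word b w) ∈ N)
    {x y : Skew (TensorAlgebra ℂ V) G}
    (hx : x ∈ skewPart G (TensorAlgebra.ι ℂ : V →ₗ[ℂ] TensorAlgebra ℂ V) p)
    (hy : y ∈ skewPart G (TensorAlgebra.ι ℂ : V →ₗ[ℂ] TensorAlgebra ℂ V) s) (i j : Fin n) :
    x * relElt q b κ i j * y ∈ N := by
  have h1 : ∀ (u w : List (Fin n)) (g : G) (i j : Fin n), u.length = p → w.length = s →
      single 1 (word b u) * relElt q b κ i j * single g (word b w) ∈ N := by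
    intro u w g i j hu hw
    rcases lt_trichotomy i j with h | rfl | h
    · exact hN u w g i j h hu hw
    · rw [relElt_diag hq hκ, mul_zero, zero_mul]
      exact zero_mem N
    · rw [relElt_swap hq hκ, mul_smul_comm, smul_mul_assoc]
      exact N.smul_mem _ (hN u w g j i h hu hw)
  have h2 : ∀ (u : List (Fin n)) (i j : Fin n) (y : Skew (TensorAlgebra ℂ V) G),
      u.length = p → y ∈ skewPart G (TensorAlgebra.ι ℂ : V →ₗ[ℂ] TensorAlgebra ℂ V) s →
      single 1 (word b u) * relElt q b κ i j * y ∈ N := by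
    intro u i j y hu hy
    rw [skewPart_tensor_eq_span b] at hy
    induction hy using Submodule.span_induction with
    | mem z hz =>
      obtain ⟨⟨w, g⟩, hw, rfl⟩ := hz
      rw [wordBasis_apply]
      exact h1 u w g i j hu hw
    | zero => rw [mul_zero]; exact zero_mem N
    | add z z' _ _ h h' => rw [mul_add]; exact add_mem h h'
    | smul c z _ h => rw [mul_smul_comm]; exact N.smul_mem _ h
  rw [skewPart_tensor_eq_span b] at hx
  induction hx using Submodule.span_induction with
  | mem z hz =>
    obtain ⟨⟨u, h⟩, hu, rfl⟩ := hz
    have hsplit : wordBasis b G (u, h) * relElt q b κ i j * y =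
        single 1 (word b u) * (single h 1 * relElt q b κ i j * single h⁻¹ 1) *
          (single h 1 * y) := by
      have e1 : (single h⁻¹ 1 * (single h 1 * y) : Skew (TensorAlgebra ℂ V) G) = y := by
        rw [← mul_assoc, single_mul_single, inv_mul_cancel, smul_one, mul_one, single_one_one,
          one_mul]
      have e2 : (single 1 (word b u) * single h 1 : Skew (TensorAlgebra ℂ V) G) =
          single h (word b u) := by
        rw [single_mul_single, one_mul, smul_one, mul_one]
      rw [wordBasis_apply, ← e2]
      conv_lhs => rw [← e1]
      simp only [mul_assoc]
    rw [hsplit]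
    have hhy : single h 1 * y ∈ skewPart G (TensorAlgebra.ι ℂ : V →ₗ[ℂ] TensorAlgebra ℂ V) s := by
      have := skewPart_mul_mem (TensorAlgebra.ι ℂ : V →ₗ[ℂ] TensorAlgebra ℂ V)
        (single_mem_skewPart (G := G) (d := 0) _ h (one_mem_degPart _)) hy
      rwa [zero_add] at this
    refine Submodule.span_induction (p := fun r _ =>
      single 1 (word b u) * r * (single h 1 * y) ∈ N) ?_ ?_ ?_ ?_ (hinv h i j)
    · rintro _ ⟨⟨k, l⟩, rfl⟩
      exact h2 u k l _ hu hhy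
    · rw [mul_zero, zero_mul]; exact zero_mem N
    · intro r r' _ _ h h'
      rw [mul_add, add_mul]; exact add_mem h h'
    · intro c r _ h
      rw [mul_smul_comm, smul_mul_assoc]; exact N.smul_mem _ h
  | zero => rw [zero_mul, zero_mul]; exact zero_mem N
  | add z z' _ _ h h' => rw [add_mul, add_mul]; exact add_mem h h'
  | smul c z _ h => rw [smul_mul_assoc, smul_mul_assoc]; exact N.smul_mem _ h

/-- These are the two ways of rewriting v_i v_j v_k. All words of length three are accounted for by
further multiples of relations, and the remainder of degree one is the Jacobi expression, the only
obstruction to confluence. -/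
theorem relElt_overlap (i j k : Fin n) :
    relElt q b κ i j * single 1 (word b [k]) - single 1 (word b [i]) * relElt q b κ j k =
      -(q i j • (single 1 (word b [j]) * relElt q b κ i k))
        + q j k • (relElt q b κ i k * single 1 (word b [j]))
        + (q j k * q i k) • (single 1 (word b [k]) * relElt q b κ i j)
        - (q i j * q i k) • (relElt q b κ j k * single 1 (word b [i]))
        - jacobi (TensorAlgebra.ι ℂ) q b κ i j k := by
  have h : ∀ i, algIncl (TensorAlgebra ℂ V) G (TensorAlgebra.ι ℂ (b i)) =
      single 1 (word b [i]) := fun i => by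
    rw [word_cons, word_nil, mul_one]; rfl
  simp only [relElt_eq, jacobi, h, mul_sub, sub_mul, mul_smul_comm, smul_mul_assoc,
    single_word_mul, List.cons_append, List.nil_append, smul_sub, smul_smul]
  rw [show q j k * q i k * q i j = q i j * q i k * q j k by ring]
  rw [show q j k * q i k = q i k * q j k by ring]
  rw [show q i j * q i k = q i k * q i j by ring]
  abel

/-- Linear maps on `T(V) ⋊ G` that vanish on the ideal of the relations can be prescribed on the
words without ascents. -/
theorem exists_linearMap_relElt (hq : IsQuantumTuple q) (hκ : IsQuantumSkew q b κ)
    (hinv : InvariantRelations q b κ)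
    (hjac : ∀ i j k, i < j → j < k → jacobi (TensorAlgebra.ι ℂ) q b κ i j k = 0)
    {X : Type*} [AddCommGroup X] [Module ℂ X] (t : List (Fin n) × G → X) :
    ∃ L : Skew (TensorAlgebra ℂ V) G →ₗ[ℂ] X, (∀ x i j y, L (x * relElt q b κ i j * y) = 0) ∧
      ∀ w g, (∀ u i j v, i < j → w ≠ u ++ i :: j :: v) → L (single g (word b w)) = t (w, g) := by
  -- A rewriting rule is a word with a marked ascent i < j, followed by a group element.
  let K := {k : List (Fin n) × Fin n × Fin n × List (Fin n) × G // k.2.1 < k.2.2.1}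
  let lead : K → List (Fin n) × G := fun k =>
    (k.1.1 ++ k.1.2.1 :: k.1.2.2.1 :: k.1.2.2.2.1, k.1.2.2.2.2)
  let ρ : K → Skew (TensorAlgebra ℂ V) G := fun k =>
    single 1 (word b k.1.1) * relElt q b κ k.1.2.1 k.1.2.2.1 *
      single k.1.2.2.2.2 (word b k.1.2.2.2.1)
  -- Letters are compared in reverse, so swapping an ascent makes a word smaller, as does removing
  -- letters. The group element plays no part in the order.
  let lt : List (Fin n) × G → List (Fin n) × G → Prop :=
    InvImage (List.Shortlex (· > ·)) Prod.fst
  have wf : WellFounded lt := InvImage.wf _ (List.Shortlex.wf wellFounded_gt)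
  have hlex : ∀ (u : List (Fin n)) {x y : List (Fin n)} {i j : Fin n}, x.length = y.length →
      i < j → List.Shortlex (· > ·) (u ++ j :: x) (u ++ i :: y) := fun u x y i j hxy hij =>
    List.Shortlex.append_left (r := (· > ·)) (t₁ := j :: x) (t₂ := i :: y)
      (List.Shortlex.of_lex (by simp [hxy]) (List.Lex.rel hij)) u
  have hswap : ∀ (u v : List (Fin n)) (i j : Fin n), i < j →
      List.Shortlex (· > ·) (u ++ j :: i :: v) (u ++ i :: j :: v) :=
    fun u v i j hij => hlex u (by simp) hij
  -- Corrections by κ are shorter, so arbitrary multiples of relations can be allowed there without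
  -- comparing letters.
  have hlow : ∀ {p s : ℕ} {w : List (Fin n) × G} {x y : Skew (TensorAlgebra ℂ V) G},
      x ∈ skewPart G (TensorAlgebra.ι ℂ : V →ₗ[ℂ] TensorAlgebra ℂ V) p →
      y ∈ skewPart G (TensorAlgebra.ι ℂ : V →ₗ[ℂ] TensorAlgebra ℂ V) s →
      p + 2 + s < w.1.length → ∀ i j, x * relElt q b κ i j * y ∈
        Submodule.span ℂ (ρ '' {l | lt (lead l) w}) := by
    intro p s w x y hx hy hlen i j
    refine skew_mul_relElt_mul_mem hq hκ hinv _ ?_ hx hy i j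
    rintro u v g i j hij rfl rfl
    refine Submodule.subset_span ⟨⟨(u, i, j, v, g), hij⟩, ?_, rfl⟩
    exact List.Shortlex.of_length_lt
      (by simp only [lead, List.length_append, List.length_cons]; omega)
  have hρ : ∀ {u v : List (Fin n)} {i j : Fin n} {g : G} {w : List (Fin n) × G}, i < j →
      List.Shortlex (· > ·) (u ++ i :: j :: v) w.1 →
      single 1 (word b u) * relElt q b κ i j * single g (word b v) ∈
        Submodule.span ℂ (ρ '' {l | lt (lead l) w}) := by
    intro u v i j g w hij hw
    exact Submodule.subset_span ⟨⟨(u, i, j, v, g), hij⟩, hw, rfl⟩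
  have hκ0 : ∀ i j, groupIncl (TensorAlgebra ℂ V) G (κ (b i) (b j)) ∈
      skewPart G (TensorAlgebra.ι ℂ : V →ₗ[ℂ] TensorAlgebra ℂ V) 0 :=
    fun i j => groupIncl_mem_skewPart _ _
  -- For ascents with no common letter, the untouched pair in each term is expanded by the other
  -- relation. The product containing both relations then occurs twice and cancels.
  have hdisj : ∀ (u c v : List (Fin n)) (i j k l : Fin n) (g : G), i < j → k < l →
      single 1 (word b u) * relElt q b κ i j * single g (word b (c ++ k :: l :: v)) -
        single 1 (word b (u ++ i :: j :: c)) * relElt q b κ k l * single g (word b v) ∈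
      Submodule.span ℂ (ρ '' {m | lt (lead m) (u ++ i :: j :: (c ++ k :: l :: v), g)}) := by
    intro u c v i j k l g hij hkl
    have e1 := word_mul_relElt_mul (q := q) (b := b) (κ := κ) c v g k l
    have e2 := word_mul_relElt_mul (q := q) (b := b) (κ := κ) u c 1 i j
    have key : single 1 (word b u) * relElt q b κ i j * single g (word b (c ++ k :: l :: v)) -
        single 1 (word b (u ++ i :: j :: c)) * relElt q b κ k l * single g (word b v) =
        q k l • (single 1 (word b u) * relElt q b κ i j * single g (word b (c ++ l :: k :: v)))
        + single 1 (word b u) * relElt q b κ i j * (single 1 (word b c) *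
          groupIncl (TensorAlgebra ℂ V) G (κ (b k) (b l)) * single g (word b v))
        - q i j • (single 1 (word b (u ++ j :: i :: c)) * relElt q b κ k l * single g (word b v))
        - (single 1 (word b u) * groupIncl (TensorAlgebra ℂ V) G (κ (b i) (b j)) *
          single 1 (word b c)) * relElt q b κ k l * single g (word b v) := by
      rw [sub_sub, eq_sub_iff_add_eq] at e1 e2
      rw [← e1, ← e2]
      simp only [mul_add, add_mul, mul_smul_comm, smul_mul_assoc, mul_assoc]
      abel
    rw [key]
    have m1 : single 1 (word b c) * groupIncl (TensorAlgebra ℂ V) G (κ (b k) (b l)) *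
        single g (word b v) ∈ skewPart G (TensorAlgebra.ι ℂ : V →ₗ[ℂ] TensorAlgebra ℂ V)
          (c.length + 0 + v.length) :=
      skewPart_mul_mem _ (skewPart_mul_mem _ (single_word_mem b c 1) (hκ0 k l))
        (single_word_mem b v g)
    have m2 : single 1 (word b u) * groupIncl (TensorAlgebra ℂ V) G (κ (b i) (b j)) *
        single 1 (word b c) ∈ skewPart G (TensorAlgebra.ι ℂ : V →ₗ[ℂ] TensorAlgebra ℂ V)
          (u.length + 0 + c.length) :=
      skewPart_mul_mem _ (skewPart_mul_mem _ (single_word_mem b u 1) (hκ0 i j))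
        (single_word_mem b c 1)
    refine sub_mem (sub_mem (add_mem (Submodule.smul_mem _ _ (hρ hij ?_))
      (hlow (single_word_mem b u 1) m1 ?_ i j)) (Submodule.smul_mem _ _ (hρ hkl ?_)))
      (hlow m2 (single_word_mem b v g) ?_ k l)
    · simpa using hswap (u ++ i :: j :: c) v k l hkl
    · simp only [List.length_append, List.length_cons]; omega
    · simpa using hswap u (c ++ k :: l :: v) i j hij
    · simp only [List.length_append, List.length_cons]; omega
  -- For ascents sharing the letter j, `relElt_overlap` applies with zero Jacobi term; the four
  -- remaining multiples have leading words u j i k v, u i k j v, u k i j v and u j k i v, all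
  -- smaller.
  have hover : ∀ (u v : List (Fin n)) (i j k : Fin n) (g : G), i < j → j < k →
      single 1 (word b u) * relElt q b κ i j * single g (word b (k :: v)) -
        single 1 (word b (u ++ [i])) * relElt q b κ j k * single g (word b v) ∈
      Submodule.span ℂ (ρ '' {m | lt (lead m) (u ++ i :: j :: k :: v, g)}) := by
    intro u v i j k g hij hjk
    have key : single 1 (word b u) * relElt q b κ i j * single g (word b (k :: v)) -
        single 1 (word b (u ++ [i])) * relElt q b κ j k * single g (word b v) =
        -(q i j • (single 1 (word b (u ++ [j])) * relElt q b κ i k * single g (word b v)))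
        + q j k • (single 1 (word b u) * relElt q b κ i k * single g (word b (j :: v)))
        + (q j k * q i k) •
          (single 1 (word b (u ++ [k])) * relElt q b κ i j * single g (word b v))
        - (q i j * q i k) •
          (single 1 (word b u) * relElt q b κ j k * single g (word b (i :: v))) := by
      have h : ∀ l, (single g (word b (l :: v)) : Skew (TensorAlgebra ℂ V) G) =
          single 1 (word b [l]) * single g (word b v) := fun l => by
        rw [single_word_mul, List.singleton_append]
      have e := congrArg (fun z => single 1 (word b u) * z * single g (word b v))
        (relElt_overlap (q := q) (b := b) (κ := κ) i j k)
      rw [hjac i j k hij hjk, sub_zero] at e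
      simp only [mul_sub, sub_mul, mul_add, add_mul, mul_neg, neg_mul, mul_smul_comm,
        smul_mul_assoc] at e
      simp only [h, ← single_word_mul u]
      simpa only [mul_assoc] using e
    rw [key]
    refine sub_mem (add_mem (add_mem (neg_mem (Submodule.smul_mem _ _ (hρ (hij.trans hjk) ?_)))
      (Submodule.smul_mem _ _ (hρ (hij.trans hjk) ?_))) (Submodule.smul_mem _ _ (hρ hij ?_)))
      (Submodule.smul_mem _ _ (hρ hjk ?_))
    all_goals simp only [List.append_assoc, List.singleton_append]
    · exact hswap u (k :: v) i j hij
    · simpa using hswap (u ++ [i]) v j k hjk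
    · exact hlex u (by simp) (hij.trans hjk)
    · exact hlex u (by simp) hij
  have hlead : ∀ k, wordBasis b G (lead k) - ρ k ∈
      Submodule.span ℂ (wordBasis b G '' {u | lt u (lead k)}) := by
    rintro ⟨⟨u, i, j, v, g⟩, hij⟩
    simp only [ρ, lead, wordBasis_apply, word_mul_relElt_mul]
    have e : ∀ x y z : Skew (TensorAlgebra ℂ V) G, x - (x - y - z) = y + z := fun x y z => by abel
    rw [e]
    refine add_mem (Submodule.smul_mem _ _ (Submodule.subset_span
      ⟨(u ++ j :: i :: v, g), hswap u v i j hij, wordBasis_apply b _ g⟩)) ?_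
    have m : single 1 (word b u) * groupIncl (TensorAlgebra ℂ V) G (κ (b i) (b j)) *
        single g (word b v) ∈ skewPart G (TensorAlgebra.ι ℂ : V →ₗ[ℂ] TensorAlgebra ℂ V)
          (u.length + 0 + v.length) :=
      skewPart_mul_mem _ (skewPart_mul_mem _ (single_word_mem b u 1) (hκ0 i j))
        (single_word_mem b v g)
    rw [skewPart_tensor_eq_span b] at m
    refine Submodule.span_mono (Set.image_mono ?_) m
    intro w hw
    have hw' : w.1.length = u.length + 0 + v.length := hw
    exact List.Shortlex.of_length_lt
      (by simp only [List.length_append, List.length_cons]; omega)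
  have hmix : ∀ (u c : List (Fin n)) (i j i' j' : Fin n) (v v' : List (Fin n)) (g : G),
      i < j → i' < j' → i :: j :: v = c ++ i' :: j' :: v' →
      single 1 (word b u) * relElt q b κ i j * single g (word b v) -
        single 1 (word b (u ++ c)) * relElt q b κ i' j' * single g (word b v') ∈
      Submodule.span ℂ (ρ '' {m | lt (lead m) (u ++ i :: j :: v, g)}) := by
    intro u c i j i' j' v v' g hij hij' h
    -- The offset `c` between the two ascents decides the case: offset 0 is the same ascent, offset
    -- 1 an overlap, and offset at least 2 disjoint ascents.
    match c, h with
    | [], h =>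
      obtain ⟨rfl, rfl, rfl⟩ : i = i' ∧ j = j' ∧ v = v' := by simpa using h
      rw [List.append_nil, sub_self]
      exact zero_mem _
    | [y], h =>
      obtain ⟨rfl, rfl, rfl⟩ : i = y ∧ j = i' ∧ v = j' :: v' := by simpa using h
      exact hover u v' i j j' g hij hij'
    | y :: z :: c, h =>
      obtain ⟨rfl, rfl, rfl⟩ : i = y ∧ j = z ∧ v = c ++ i' :: j' :: v' := by simpa using h
      exact hdisj u c v' i j i' j' g hij hij'
  have hconf : ∀ k k', lead k = lead k' →
      ρ k - ρ k' ∈ Submodule.span ℂ (ρ '' {l | lt (lead l) (lead k)}) := by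
    rintro ⟨⟨u, i, j, v, g⟩, hij⟩ ⟨⟨u', i', j', v', g'⟩, hij'⟩ heq
    obtain ⟨h1, rfl⟩ : u ++ i :: j :: v = u' ++ i' :: j' :: v' ∧ g = g' := by
      simpa [lead] using heq
    rcases List.append_eq_append_iff.1 h1 with ⟨c, rfl, h⟩ | ⟨c, rfl, h⟩
    · exact hmix u c i j i' j' v v' g hij hij' h
    · rw [heq, ← neg_sub]
      exact neg_mem (hmix u' c i' j' i j v' v g hij' hij h)
  obtain ⟨L, hL, ht⟩ := exists_linearMap_of_confluent (wordBasis b G) wf lead ρ hlead hconf t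
  refine ⟨L, fun x i j y => ?_, fun w g hw => ?_⟩
  · have hx : x ∈ ⨆ d, skewPart G (TensorAlgebra.ι ℂ : V →ₗ[ℂ] TensorAlgebra ℂ V) d := by
      rw [iSup_skewPart_tensor G b]; trivial
    have hy : y ∈ ⨆ d, skewPart G (TensorAlgebra.ι ℂ : V →ₗ[ℂ] TensorAlgebra ℂ V) d := by
      rw [iSup_skewPart_tensor G b]; trivial
    induction hx using Submodule.iSup_induction' with
    | mem p x hx =>
      induction hy using Submodule.iSup_induction' with
      | mem s y hy =>
        refine skew_mul_relElt_mul_mem hq hκ hinv (LinearMap.ker L) ?_ hx hy i j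
        intro u v g i j hij _ _
        exact hL ⟨(u, i, j, v, g), hij⟩
      | zero => rw [mul_zero, map_zero]
      | add y y' _ _ h h' => rw [mul_add, map_add, h, h', add_zero]
    | zero => rw [zero_mul, zero_mul, map_zero]
    | add x x' _ _ h h' => rw [add_mul, add_mul, map_add, h, h', add_zero]
  · rw [← wordBasis_apply]
    refine ht _ ?_
    rintro ⟨⟨⟨u, i, j, v, g'⟩, hij⟩, hk⟩
    exact hw u i j v hij (congrArg Prod.fst hk).symm

end NormalForm

/-! ### ### Leading terms modulo the deformed relations -/

section Graded

variable {n : ℕ} {G V : Type*} [Group G] [AddCommGroup V] [Module ℂ V] [DistribMulAction G V]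
  [SMulCommClass G ℂ V] {q : Fin n → Fin n → ℂ} {b : Module.Basis (Fin n) ℂ V}
  {κ : V →ₗ[ℂ] V →ₗ[ℂ] MonoidAlgebra ℂ G}

/-- A linear map on `T(V) ⋊ G` that is compatible with the homogeneous relations agrees in degree
`d` with a linear map that vanishes in lower degrees and on the ideal of the deformed relations. -/
theorem exists_linearMap_eq_on_degree (hq : IsQuantumTuple q) (hκ : IsQuantumSkew q b κ)
    (hinv : InvariantRelations q b κ)
    (hjac : ∀ i j k, i < j → j < k → jacobi (TensorAlgebra.ι ℂ) q b κ i j k = 0)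
    {X : Type*} [AddCommGroup X] [Module ℂ X] (π : Skew (TensorAlgebra ℂ V) G →ₗ[ℂ] X)
    (hπ : ∀ u v g i j, π (single g (word b (u ++ i :: j :: v))) =
      q i j • π (single g (word b (u ++ j :: i :: v)))) (d : ℕ) :
    ∃ L : Skew (TensorAlgebra ℂ V) G →ₗ[ℂ] X, (∀ x i j y, L (x * relElt q b κ i j * y) = 0) ∧
      (∀ y ∈ skewPart G (TensorAlgebra.ι ℂ : V →ₗ[ℂ] TensorAlgebra ℂ V) d, L y = π y) ∧
      ∀ e < d, ∀ y ∈ skewPart G (TensorAlgebra.ι ℂ : V →ₗ[ℂ] TensorAlgebra ℂ V) e, L y = 0 := by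
  -- On words without ascents `L` is chosen to be π in length `d` and zero in every other length.
  obtain ⟨L, hL, ht⟩ := exists_linearMap_relElt hq hκ hinv hjac
    (fun w => if w.1.length = d then π (single w.2 (word b w.1)) else 0)
  have hzero : ∀ e, (∀ w g, w.length = e → L (single g (word b w)) = 0) →
      ∀ y ∈ skewPart G (TensorAlgebra.ι ℂ : V →ₗ[ℂ] TensorAlgebra ℂ V) e, L y = 0 := by
    intro e he y hy
    rw [skewPart_tensor_eq_span b] at hy
    refine (Submodule.span_le (p := LinearMap.ker L)).2 ?_ hy
    rintro _ ⟨⟨w, g⟩, hw, rfl⟩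
    rw [wordBasis_apply]
    exact he w g hw
  -- Up to length `d` the κ-correction has length below `d`, where `L` vanishes by induction. So `L`
  -- obeys the same homogeneous swapping rule as π, and both are determined by words without
  -- ascents.
  have key : ∀ w g, w.length ≤ d → L (single g (word b w)) =
      if w.length = d then π (single g (word b w)) else 0 := by
    intro w
    induction w using
      (List.Shortlex.wf (r := fun i j : Fin n => i > j) wellFounded_gt).induction with
    | _ w ih =>
      intro g hw
      by_cases h : ∀ u i j v, i < j → w ≠ u ++ i :: j :: v
      · exact ht w g h
      · push Not at h
        obtain ⟨u, i, j, v, hij, rfl⟩ := h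
        have e := hL (single 1 (word b u)) i j (single g (word b v))
        have m : single 1 (word b u) * groupIncl (TensorAlgebra ℂ V) G (κ (b i) (b j)) *
            single g (word b v) ∈ skewPart G (TensorAlgebra.ι ℂ : V →ₗ[ℂ] TensorAlgebra ℂ V)
              (u.length + 0 + v.length) :=
          skewPart_mul_mem _ (skewPart_mul_mem _ (single_word_mem b u 1)
            (groupIncl_mem_skewPart _ _)) (single_word_mem b v g)
        have hlen : (u ++ i :: j :: v).length = u.length + v.length + 2 := by
          simp only [List.length_append, List.length_cons]; omega
        have hlen' : (u ++ j :: i :: v).length = u.length + v.length + 2 := by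
          simp only [List.length_append, List.length_cons]; omega
        rw [word_mul_relElt_mul, map_sub, hzero _ ?_ _ m, sub_zero, map_sub, sub_eq_zero,
          map_smul] at e
        · rw [e, ih (u ++ j :: i :: v) (List.Shortlex.append_left (r := (· > ·))
            (t₁ := j :: i :: v) (t₂ := i :: j :: v)
            (List.Shortlex.of_lex (by simp) (List.Lex.rel hij)) u) g (by omega),
            hπ u v g i j, hlen, hlen']
          split_ifs <;> simp
        · intro w' g' hw'
          rw [ih w' (List.Shortlex.of_length_lt (by omega)) g' (by omega), if_neg (by omega)]
  refine ⟨L, hL, fun y hy => ?_, fun e he => hzero e fun w g hw => ?_⟩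
  · rw [skewPart_tensor_eq_span b] at hy
    refine (Submodule.span_le (p := LinearMap.eqLocus L π)).2 ?_ hy
    rintro _ ⟨⟨w, g⟩, hw, rfl⟩
    have hw' : w.length = d := hw
    show L _ = π _
    rw [wordBasis_apply, key w g hw'.le, if_pos hw']
  · rw [key w g (by omega), if_neg (by omega)]

theorem mem_ker_of_heckeMk_eq_zero {X : Type*} [AddCommGroup X] [Module ℂ X]
    (L : Skew (TensorAlgebra ℂ V) G →ₗ[ℂ] X) (hL : ∀ x i j y, L (x * relElt q b κ i j * y) = 0)
    {y : Skew (TensorAlgebra ℂ V) G} (hy : heckeMk q b κ y = 0) : L y = 0 := by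
  let I : Submodule ℂ (Skew (TensorAlgebra ℂ V) G) :=
    Submodule.span ℂ {z | ∃ x i j y, z = x * relElt q b κ i j * y}
  have h : y ∈ I := by
    refine mem_of_mkAlgHom_eq_zero I ?_ (fun a z hz => ?_) (fun a z hz => ?_) hy
    · rintro _ _ ⟨i, j⟩
      exact Submodule.subset_span ⟨1, i, j, 1, by rw [one_mul, mul_one, relElt]⟩
    · induction hz using Submodule.span_induction with
      | mem z hz =>
        obtain ⟨x, i, j, y, rfl⟩ := hz
        exact Submodule.subset_span ⟨a * x, i, j, y, by simp only [mul_assoc]⟩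
      | zero => rw [mul_zero]; exact zero_mem I
      | add z z' _ _ h h' => rw [mul_add]; exact add_mem h h'
      | smul c z _ h => rw [mul_smul_comm]; exact I.smul_mem c h
    · induction hz using Submodule.span_induction with
      | mem z hz =>
        obtain ⟨x, i, j, y, rfl⟩ := hz
        exact Submodule.subset_span ⟨x, i, j, y * a, by simp only [mul_assoc]⟩
      | zero => rw [zero_mul]; exact zero_mem I
      | add z z' _ _ h h' => rw [add_mul]; exact add_mem h h'
      | smul c z _ h => rw [smul_mul_assoc]; exact I.smul_mem c h
  refine (Submodule.span_le (p := LinearMap.ker L)).2 ?_ h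
  rintro _ ⟨x, i, j, y, rfl⟩
  exact hL x i j y

theorem symι_mul_symι (i j : Fin n) :
    symι q b (b i) * symι q b (b j) = q i j • (symι q b (b j) * symι q b (b i)) := by
  have h := RingQuot.mkAlgHom_rel ℂ (SymRel.rel (q := q) (b := b) i j)
  rw [map_smul, map_mul, map_mul] at h
  exact h

theorem symMk_word_swap (u v : List (Fin n)) (i j : Fin n) :
    symMk q b (word b (u ++ i :: j :: v)) = q i j • symMk q b (word b (u ++ j :: i :: v)) := by
  have h : ∀ i j, symMk q b (word b (u ++ i :: j :: v)) =
      symMk q b (word b u) * (symι q b (b i) * symι q b (b j)) * symMk q b (word b v) := by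
    intro i j
    rw [word_append, word_cons, word_cons, map_mul, map_mul, map_mul]
    simp only [mul_assoc]
    rfl
  rw [h, h, symι_mul_symι, mul_smul_comm, smul_mul_assoc]

variable [MulSemiringAction G (QuantumSym q b)] [SMulCommClass G ℂ (QuantumSym q b)]
  [ExtendsAction G (symι q b)]

theorem symMk_smul (g : G)
    (x : TensorAlgebra ℂ V) : symMk q b (g • x) = g • symMk q b x := by
  have h : (symMk q b).comp (MulSemiringAction.toAlgHom ℂ (TensorAlgebra ℂ V) g) =
      (MulSemiringAction.toAlgHom ℂ (QuantumSym q b) g).comp (symMk q b) := by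
    ext v
    show symMk q b (g • TensorAlgebra.ι ℂ v) = g • symι q b v
    rw [ExtendsAction.smul_ι, ExtendsAction.smul_ι]
    rfl
  exact DFunLike.congr_fun h x

variable (G q b) in
/-- The projection `T(V) ⋊ G → S_q(V) ⋊ G`. -/
def skewSymMk : Skew (TensorAlgebra ℂ V) G →ₐ[ℂ] Skew (QuantumSym q b) G :=
  liftNCAlgHom ((algIncl (QuantumSym q b) G).comp (symMk q b)) (of (QuantumSym q b) G) (by
    intro x g
    show single 1 (symMk q b (g • x)) * of (QuantumSym q b) G g =
      of (QuantumSym q b) G g * single 1 (symMk q b x)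
    rw [of_apply, single_mul_single, single_mul_single, symMk_smul]
    simp)

theorem skewSymMk_single (g : G) (x : TensorAlgebra ℂ V) :
    skewSymMk G q b (single g x) = single g (symMk q b x) := by
  have h : skewSymMk G q b (single g x) =
      single 1 (symMk q b x) * of (QuantumSym q b) G g := liftNC_single _ _ _ _
  rw [h, of_apply, single_mul_single]
  simp

theorem skewSymMk_surjective : Function.Surjective (skewSymMk G q b) := by
  intro x
  induction x using SkewMonoidAlgebra.induction_on with
  | zero => exact ⟨0, map_zero _⟩
  | single g a =>
    obtain ⟨x, rfl⟩ := RingQuot.mkAlgHom_surjective ℂ (SymRel q b) a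
    exact ⟨single g x, skewSymMk_single g x⟩
  | add x y hx hy =>
    obtain ⟨x, rfl⟩ := hx
    obtain ⟨y, rfl⟩ := hy
    exact ⟨x + y, map_add _ _ _⟩

theorem skewSymMk_algIncl (x : TensorAlgebra ℂ V) :
    skewSymMk G q b (algIncl _ G x) = algIncl _ G (symMk q b x) := skewSymMk_single 1 x

theorem skewSymMk_groupIncl (x : MonoidAlgebra ℂ G) :
    skewSymMk G q b (groupIncl _ G x) = groupIncl _ G x := by
  have h : (skewSymMk G q b).comp (groupIncl (TensorAlgebra ℂ V) G) =
      groupIncl (QuantumSym q b) G := by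
    ext g
    simp [groupIncl, skewSymMk_single]
  exact DFunLike.congr_fun h x

/-- If an element of degree `d` drops in filtration degree in `H_{q,κ}`, it is zero in
`S_q(V) ⋊ G`. -/
theorem skewSymMk_eq_zero_of_mem_filtBelow (hq : IsQuantumTuple q) (hκ : IsQuantumSkew q b κ)
    (hinv : InvariantRelations q b κ)
    (hjac : ∀ i j k, i < j → j < k → jacobi (TensorAlgebra.ι ℂ) q b κ i j k = 0) {d : ℕ}
    {y : Skew (TensorAlgebra ℂ V) G}
    (hy : y ∈ skewPart G (TensorAlgebra.ι ℂ : V →ₗ[ℂ] TensorAlgebra ℂ V) d)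
    (h : heckeMk q b κ y ∈ filtBelow (heckeFilt q b κ) d) : skewSymMk G q b y = 0 := by
  obtain ⟨L, hL, htop, hlow⟩ := exists_linearMap_eq_on_degree hq hκ hinv hjac
    (skewSymMk G q b).toLinearMap (by
      intro u v g i j
      rw [AlgHom.toLinearMap_apply, skewSymMk_single, AlgHom.toLinearMap_apply, skewSymMk_single,
        symMk_word_swap, smul_single]) d
  have hle : filtBelow (heckeFilt q b κ) d ≤ (⨆ (e : ℕ) (_ : e < d),
      skewPart G (TensorAlgebra.ι ℂ : V →ₗ[ℂ] TensorAlgebra ℂ V) e).map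
        (heckeMk q b κ).toLinearMap := by
    refine iSup₂_le fun e he => Submodule.map_mono (iSup₂_le fun f hf => ?_)
    exact le_iSup₂_of_le f (by omega) le_rfl
  obtain ⟨z, hz, hzy⟩ := hle h
  have hLz : L z = 0 := by
    have : (⨆ (e : ℕ) (_ : e < d),
        skewPart G (TensorAlgebra.ι ℂ : V →ₗ[ℂ] TensorAlgebra ℂ V) e) ≤ LinearMap.ker L :=
      iSup₂_le fun e he x hx => hlow e he x hx
    exact this hz
  have hzy' : heckeMk q b κ (y - z) = 0 := by
    rw [map_sub, sub_eq_zero]; exact hzy.symm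
  -- Here `y - z` lies in the ideal and `z` in lower degrees, and `L` kills both while agreeing with
  -- the projection at `y`.
  have := mem_ker_of_heckeMk_eq_zero L hL hzy'
  rw [map_sub, hLz, sub_zero, htop y hy] at this
  exact this

end Graded

/-! ### The comparison map to the associated graded algebra -/

section Symbols

variable {H : Type*} [Ring H] [Algebra ℂ H] (F : ℕ → Submodule ℂ H)

/-- The symbol map as a linear map. -/
def symbolₗ (d : ℕ) : F d →ₗ[ℂ] Gr F := (DirectSum.lof ℂ ℕ (GrPiece F) d).comp (grMk F d)

theorem symbolₗ_apply (d : ℕ) (x : F d) : symbolₗ F d x = symbol F d x := rfl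

theorem symbol_eq_zero {d : ℕ} (x : F d) : symbol F d x = 0 ↔ (x : H) ∈ filtBelow F d := by
  rw [← grMk_eq_zero, symbol]
  exact ⟨fun h => DirectSum.of_injective (β := GrPiece F) d (h.trans (map_zero _).symm),
    fun h => by rw [h, map_zero]⟩

theorem symbol_congr {i j : ℕ} (h : i = j) {x : F i} {y : F j} (hxy : (x : H) = y) :
    symbol F i x = symbol F j y := by
  subst h
  obtain rfl : x = y := Subtype.ext hxy
  rfl

variable [SetLike.GradedMonoid F]

theorem symbol_mul {i j : ℕ} (x : F i) (y : F j) :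
    symbol F i x * symbol F j y =
      symbol F (i + j) ⟨(x : H) * (y : H), SetLike.GradedMul.mul_mem x.2 y.2⟩ :=
  DirectSum.of_mul_of _ _

theorem symbol_one : symbol F 0 ⟨1, SetLike.GradedOne.one_mem⟩ = 1 := rfl

end Symbols

section Comparison

variable {n : ℕ} {G V : Type*} [Group G] [AddCommGroup V] [Module ℂ V] [DistribMulAction G V]
  [SMulCommClass G ℂ V] (q : Fin n → Fin n → ℂ) (b : Module.Basis (Fin n) ℂ V)
  (κ : V →ₗ[ℂ] V →ₗ[ℂ] MonoidAlgebra ℂ G)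

/-- The symbols of the vectors in the associated graded algebra of `H_{q,κ}`. -/
def symbolV : V →ₗ[ℂ] Gr (heckeFilt q b κ) :=
  (symbolₗ (heckeFilt q b κ) 1).comp
    ({ toFun := heckeV q b κ
       map_add' := fun v w => Subtype.ext (by simp [heckeV, single_add])
       map_smul' := fun c v => Subtype.ext (by
        show heckeMk q b κ _ = c • heckeMk q b κ _
        rw [map_smul, ← SkewMonoidAlgebra.smul_single, map_smul]) } : V →ₗ[ℂ] heckeFilt q b κ 1)

theorem symbolV_apply (v : V) : symbolV q b κ v = symbol _ 1 (heckeV q b κ v) := rfl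

/-- The symbols of the group elements in the associated graded algebra of `H_{q,κ}`. -/
def symbolG : G →* Gr (heckeFilt q b κ) where
  toFun g := symbol _ 0 (heckeG q b κ g)
  map_one' := by
    rw [← symbol_one]
    exact symbol_congr _ rfl (map_one (heckeMk q b κ))
  map_mul' g h := by
    rw [symbol_mul]
    refine symbol_congr _ rfl ?_
    show heckeMk q b κ _ = heckeMk q b κ _ * heckeMk q b κ _
    rw [← map_mul, single_mul_single, smul_one, mul_one]

theorem symbolG_apply (g : G) : symbolG q b κ g = symbol _ 0 (heckeG q b κ g) := rfl

/-- The defect is κ(v_i, v_j), of filtration degree zero, so its symbol in degree two vanishes. -/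
theorem symbolV_mul (i j : Fin n) :
    symbolV q b κ (b i) * symbolV q b κ (b j) =
      q i j • (symbolV q b κ (b j) * symbolV q b κ (b i)) := by
  simp only [symbolV_apply, symbol_mul]
  rw [← sub_eq_zero, ← symbolₗ_apply, ← symbolₗ_apply, ← map_smul, ← map_sub, symbolₗ_apply,
    symbol_eq_zero]
  have h : heckeMk q b κ (groupIncl (TensorAlgebra ℂ V) G (κ (b i) (b j))) ∈
      filtBelow (heckeFilt q b κ) (1 + 1) :=
    (le_iSup₂_of_le 0 (by omega) le_rfl : heckeFilt q b κ 0 ≤ _)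
      (heckeMk_mem q b κ (groupIncl_mem_skewPart _ _))
  have hrel : heckeMk q b κ (algIncl (TensorAlgebra ℂ V) G
      (TensorAlgebra.ι ℂ (b i) * TensorAlgebra.ι ℂ (b j)
        - q i j • (TensorAlgebra.ι ℂ (b j) * TensorAlgebra.ι ℂ (b i)))) =
      heckeMk q b κ (groupIncl (TensorAlgebra ℂ V) G (κ (b i) (b j))) :=
    RingQuot.mkAlgHom_rel ℂ (HeckeRel.rel i j)
  rw [← hrel] at h
  convert h using 1
  rw [map_sub, map_sub, map_smul, map_smul, map_mul, map_mul, map_mul, map_mul]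
  rfl

/-- The algebra map from `S_q(V)` to the associated graded algebra of `H_{q,κ}`. -/
def symToGr : QuantumSym q b →ₐ[ℂ] Gr (heckeFilt q b κ) :=
  RingQuot.liftAlgHom ℂ ⟨TensorAlgebra.lift ℂ (symbolV q b κ), by
    rintro _ _ ⟨i, j⟩
    simp only [map_mul, map_smul, TensorAlgebra.lift_ι_apply]
    exact symbolV_mul q b κ i j⟩

theorem symToGr_symMk (x : TensorAlgebra ℂ V) :
    symToGr q b κ (symMk q b x) = TensorAlgebra.lift ℂ (symbolV q b κ) x :=
  RingQuot.liftAlgHom_mkAlgHom_apply _ _ _ _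

theorem symToGr_symι (v : V) : symToGr q b κ (symι q b v) = symbolV q b κ v := by
  rw [symι, LinearMap.comp_apply, AlgHom.toLinearMap_apply, symToGr_symMk,
    TensorAlgebra.lift_ι_apply]

theorem symbolV_smul (g : G) (v : V) :
    symbolV q b κ (g • v) * symbolG q b κ g = symbolG q b κ g * symbolV q b κ v := by
  simp only [symbolV_apply, symbolG_apply, symbol_mul]
  refine symbol_congr _ rfl ?_
  show heckeMk q b κ _ * heckeMk q b κ _ = heckeMk q b κ _ * heckeMk q b κ _
  rw [← map_mul, ← map_mul, single_mul_single, single_mul_single, ExtendsAction.smul_ι]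
  simp

variable [MulSemiringAction G (QuantumSym q b)] [SMulCommClass G ℂ (QuantumSym q b)]
  [ExtendsAction G (symι q b)]

theorem symToGr_smul (g : G) (a : QuantumSym q b) :
    symToGr q b κ (g • a) * symbolG q b κ g = symbolG q b κ g * symToGr q b κ a := by
  obtain ⟨x, rfl⟩ := RingQuot.mkAlgHom_surjective ℂ (SymRel q b) a
  change symToGr q b κ (g • symMk q b x) * _ = _ * symToGr q b κ (symMk q b x)
  rw [← symMk_smul]
  induction x using TensorAlgebra.induction with
  | algebraMap r => rw [smul_algebraMap, AlgHom.commutes, AlgHom.commutes, Algebra.commutes]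
  | ι v =>
    rw [ExtendsAction.smul_ι]
    exact (congrArg (· * _) (symToGr_symι q b κ _)).trans
      ((symbolV_smul q b κ g v).trans (congrArg (_ * ·) (symToGr_symι q b κ v).symm))
  | mul x y hx hy =>
    rw [smul_mul', map_mul, map_mul, mul_assoc, hy, ← mul_assoc, hx, mul_assoc, ← map_mul,
      ← map_mul]
  | add x y hx hy => rw [smul_add, map_add, map_add, add_mul, hx, hy, map_add, map_add, mul_add]

/-- The algebra map from `S_q(V) ⋊ G` to the associated graded algebra of `H_{q,κ}`. -/
def skewToGr : Skew (QuantumSym q b) G →ₐ[ℂ] Gr (heckeFilt q b κ) :=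
  liftNCAlgHom (symToGr q b κ) (symbolG q b κ) (symToGr_smul q b κ _ _)

theorem skewToGr_single (g : G) (a : QuantumSym q b) :
    skewToGr q b κ (single g a) = symToGr q b κ a * symbolG q b κ g := liftNC_single _ _ _ _

variable {q b κ}

/-- Symbols are multiplicative, so it suffices to treat words times group elements. Both
surjectivity and injectivity of the comparison map are read off from this formula. -/
theorem skewToGr_skewSymMk {d : ℕ} {y : Skew (TensorAlgebra ℂ V) G}
    (hy : y ∈ skewPart G (TensorAlgebra.ι ℂ : V →ₗ[ℂ] TensorAlgebra ℂ V) d) :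
    skewToGr q b κ (skewSymMk G q b y) = symbol _ d ⟨heckeMk q b κ y, heckeMk_mem q b κ hy⟩ := by
  have hword : ∀ w : List (Fin n), symToGr q b κ (symMk q b (word b w)) =
      symbol _ w.length ⟨heckeMk q b κ (single 1 (word b w)),
        heckeMk_mem q b κ (single_word_mem b w 1)⟩ := by
    intro w
    induction w with
    | nil =>
      have h : symToGr q b κ (symMk q b (word b [])) = 1 := by rw [word_nil, map_one, map_one]
      rw [h, ← symbol_one]
      exact symbol_congr _ rfl (map_one (heckeMk q b κ)).symm
    | cons i w ih =>
      have h : symToGr q b κ (symMk q b (TensorAlgebra.ι ℂ (b i))) =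
          symbol _ 1 (heckeV q b κ (b i)) :=
        (symToGr_symι q b κ (b i)).trans (symbolV_apply q b κ (b i))
      have h' : symToGr q b κ (symMk q b (word b (i :: w))) =
          symToGr q b κ (symMk q b (TensorAlgebra.ι ℂ (b i))) *
            symToGr q b κ (symMk q b (word b w)) := by rw [word_cons, map_mul, map_mul]
      rw [h', ih, h, symbol_mul]
      refine symbol_congr _ (by simp [add_comm]) ?_
      show heckeMk q b κ _ * heckeMk q b κ _ = heckeMk q b κ _
      rw [← map_mul, single_mul_single, one_mul, one_smul, word_cons]
  have hsingle : ∀ (w : List (Fin n)) (g : G), skewToGr q b κ (skewSymMk G q b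
      (single g (word b w))) = symbol _ w.length ⟨heckeMk q b κ (single g (word b w)),
        heckeMk_mem q b κ (single_word_mem b w g)⟩ := by
    intro w g
    rw [skewSymMk_single, skewToGr_single, hword, symbolG_apply, symbol_mul]
    refine symbol_congr _ rfl ?_
    show heckeMk q b κ _ * heckeMk q b κ _ = heckeMk q b κ _
    rw [← map_mul, single_mul_single, one_mul, one_smul, mul_one]
  have hspan := hy
  rw [skewPart_tensor_eq_span b] at hspan
  induction hspan using Submodule.span_induction with
  | mem y h =>
    obtain ⟨⟨w, g⟩, hw, rfl⟩ := h
    refine (congrArg (fun z => skewToGr q b κ (skewSymMk G q b z))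
      (wordBasis_apply b w g)).trans ((hsingle w g).trans (symbol_congr _ hw ?_))
    show heckeMk q b κ _ = heckeMk q b κ _
    rw [wordBasis_apply]
  | zero =>
    rw [map_zero, map_zero, eq_comm, symbol_eq_zero]
    show heckeMk q b κ 0 ∈ _
    rw [map_zero]
    exact zero_mem _
  | add y z hy' hz' h h' =>
    rw [← skewPart_tensor_eq_span b] at hy' hz'
    rw [map_add, map_add, h hy', h' hz', ← symbolₗ_apply, ← symbolₗ_apply, ← map_add]
    exact symbol_congr _ rfl (map_add (heckeMk q b κ) y z).symm
  | smul c y hy' h =>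
    rw [← skewPart_tensor_eq_span b] at hy'
    rw [map_smul, map_smul, h hy', ← symbolₗ_apply, ← map_smul]
    exact symbol_congr _ rfl (map_smul (heckeMk q b κ) c y).symm

/-- Modulo lower filtration, an element of F_d is the image of an element homogeneous of degree d,
and the lower terms do not affect the symbol. -/
theorem skewToGr_surjective : Function.Surjective (skewToGr q b κ) := by
  intro z
  induction z using DirectSum.induction_on with
  | zero => exact ⟨0, map_zero _⟩
  | add x y hx hy =>
    obtain ⟨x, rfl⟩ := hx
    obtain ⟨y, rfl⟩ := hy
    exact ⟨x + y, map_add _ _ _⟩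
  | of d z =>
    obtain ⟨⟨_, y, hy, rfl⟩, rfl⟩ := grMk_surjective (heckeFilt q b κ) d z
    have hsup : (⨆ (e : ℕ) (_ : e ≤ d),
        skewPart G (TensorAlgebra.ι ℂ : V →ₗ[ℂ] TensorAlgebra ℂ V) e) ≤
        skewPart G (TensorAlgebra.ι ℂ : V →ₗ[ℂ] TensorAlgebra ℂ V) d ⊔
        (⨆ (e : ℕ) (_ : e < d), skewPart G (TensorAlgebra.ι ℂ : V →ₗ[ℂ] TensorAlgebra ℂ V) e) := by
      refine iSup₂_le fun e he => ?_
      rcases he.eq_or_lt with rfl | he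
      · exact le_sup_left
      · exact le_sup_of_le_right (le_iSup₂_of_le e he le_rfl)
    obtain ⟨x, hx, y', hy', rfl⟩ := Submodule.mem_sup.1 (hsup hy)
    refine ⟨skewSymMk G q b x, ?_⟩
    rw [skewToGr_skewSymMk hx]
    change _ = symbol _ d _
    rw [← sub_eq_zero, ← symbolₗ_apply, ← symbolₗ_apply, ← map_sub, symbolₗ_apply, symbol_eq_zero]
    show heckeMk q b κ x - heckeMk q b κ (x + y') ∈ _
    rw [map_add, sub_add_cancel_left]
    refine neg_mem ?_
    have hle : (⨆ (e : ℕ) (_ : e < d),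
        skewPart G (TensorAlgebra.ι ℂ : V →ₗ[ℂ] TensorAlgebra ℂ V) e) ≤
        (filtBelow (heckeFilt q b κ) d).comap (heckeMk q b κ).toLinearMap :=
      iSup₂_le fun e he t ht =>
        (le_iSup₂_of_le e he le_rfl : heckeFilt q b κ e ≤ filtBelow (heckeFilt q b κ) d)
          (heckeMk_mem q b κ ht)
    exact hle hy'

/-- A preimage in T(V) ⋊ G splits into homogeneous components whose symbols lie in different
degrees. Each symbol is therefore zero, so each component drops in filtration and vanishes in S_q(V)
⋊ G. -/
theorem skewToGr_injective (hq : IsQuantumTuple q) (hκ : IsQuantumSkew q b κ)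
    (hinv : InvariantRelations q b κ)
    (hjac : ∀ i j k, i < j → j < k → jacobi (TensorAlgebra.ι ℂ) q b κ i j k = 0) :
    Function.Injective (skewToGr q b κ) := by
  rw [injective_iff_map_eq_zero]
  intro x hx
  obtain ⟨y, rfl⟩ := skewSymMk_surjective (G := G) (q := q) (b := b) x
  have hy : y ∈ ⨆ d, skewPart G (TensorAlgebra.ι ℂ : V →ₗ[ℂ] TensorAlgebra ℂ V) d := by
    rw [iSup_skewPart_tensor G b]; trivial
  obtain ⟨f, hf, rfl⟩ := (Submodule.mem_iSup_iff_exists_finsupp _ _).1 hy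
  rw [Finsupp.sum, _root_.map_sum, _root_.map_sum] at hx
  rw [Finsupp.sum, _root_.map_sum]
  refine Finset.sum_eq_zero fun d hd => ?_
  refine skewSymMk_eq_zero_of_mem_filtBelow hq hκ hinv hjac (hf d) ?_
  have h := congrArg (DirectSum.component ℂ ℕ (GrPiece (heckeFilt q b κ)) d) hx
  rw [_root_.map_sum, map_zero, Finset.sum_eq_single d] at h
  · rw [skewToGr_skewSymMk (hf d)] at h
    change DirectSum.component ℂ ℕ _ d (DirectSum.lof ℂ ℕ _ d _) = 0 at h
    rw [DirectSum.component.lof_self, grMk_eq_zero] at h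
    exact h
  · intro e _ hed
    rw [skewToGr_skewSymMk (hf e)]
    change DirectSum.component ℂ ℕ _ d (DirectSum.lof ℂ ℕ _ e _) = 0
    rw [DirectSum.component.of, dif_neg hed]
  · exact fun h => absurd hd h

/-- The Poincaré–Birkhoff–Witt theorem for `H_{q,κ}`. -/
theorem isQuantumDrinfeldHecke_of_jacobi (hq : IsQuantumTuple q) (hκ : IsQuantumSkew q b κ)
    (hinv : InvariantRelations q b κ)
    (hjac : ∀ i j k, i < j → j < k → jacobi (TensorAlgebra.ι ℂ) q b κ i j k = 0) :
    IsQuantumDrinfeldHecke q b κ := by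
  let e := AlgEquiv.ofBijective (skewToGr q b κ)
    ⟨skewToGr_injective hq hκ hinv hjac, skewToGr_surjective⟩
  refine ⟨e.symm, fun v => ?_, fun g => ?_⟩
  · rw [AlgEquiv.symm_apply_eq]
    show _ = skewToGr q b κ _
    rw [skewToGr_single, symToGr_symι, map_one, mul_one, symbolV_apply]
  · rw [AlgEquiv.symm_apply_eq]
    show _ = skewToGr q b κ _
    rw [skewToGr_single, map_one, one_mul, symbolG_apply]

end Comparison

/-! ### The quantum symmetric algebra in degrees at most two -/

section Detect

variable {n : ℕ} {V Q : Type*} [AddCommGroup V] [Module ℂ V] [AddCommGroup Q] [Module ℂ Q]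
  {q : Fin n → Fin n → ℂ} {b : Module.Basis (Fin n) ℂ V}

/-- The action of `V` on `ℂ ⊕ V ⊕ Q` that sends `(c, u, s)` to `(0, c v, φ(v, u))`. -/
def truncatedAction (φ : V →ₗ[ℂ] V →ₗ[ℂ] Q) : V →ₗ[ℂ] Module.End ℂ (ℂ × V × Q) :=
  LinearMap.mk₂ ℂ (fun v x => (0, x.1 • v, φ v x.2.1))
    (fun v w x => by simp) (fun c v x => by simp [smul_comm c])
    (fun v x y => by simp [add_smul]) (fun c v x => by simp [mul_smul])

theorem truncatedAction_apply (φ : V →ₗ[ℂ] V →ₗ[ℂ] Q) (v : V) (x : ℂ × V × Q) :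
    truncatedAction φ v x = (0, x.1 • v, φ v x.2.1) := rfl

/-- The representation of `S_q(V)` on `ℂ ⊕ V ⊕ Q` given by a bilinear map that respects the
relations. -/
def truncatedRep (φ : V →ₗ[ℂ] V →ₗ[ℂ] Q)
    (hφ : ∀ i j, φ (b i) (b j) = q i j • φ (b j) (b i)) :
    QuantumSym q b →ₐ[ℂ] Module.End ℂ (ℂ × V × Q) :=
  RingQuot.liftAlgHom ℂ ⟨TensorAlgebra.lift ℂ (truncatedAction φ), by
    rintro _ _ ⟨i, j⟩
    refine LinearMap.ext fun x => ?_
    simp only [map_mul, map_smul, TensorAlgebra.lift_ι_apply, Module.End.mul_apply,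
      LinearMap.smul_apply, truncatedAction_apply]
    simp only [zero_smul, Prod.smul_mk, smul_zero, hφ i j]
    rw [smul_comm]⟩

theorem truncatedRep_symι (φ : V →ₗ[ℂ] V →ₗ[ℂ] Q)
    (hφ : ∀ i j, φ (b i) (b j) = q i j • φ (b j) (b i)) (v : V) :
    truncatedRep φ hφ (symι q b v) = truncatedAction φ v :=
  (RingQuot.liftAlgHom_mkAlgHom_apply _ _ _ _).trans (TensorAlgebra.lift_ι_apply _ _)

/-- Acting on (1, 0, 0), the image of v recovers v; the choice φ = 0 is enough. -/
theorem symι_injective : Function.Injective (symι q b) := by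
  rw [injective_iff_map_eq_zero]
  intro v hv
  have h := truncatedRep_symι (q := q) (b := b) (0 : V →ₗ[ℂ] V →ₗ[ℂ] ℂ) (by simp) v
  rw [hv, map_zero] at h
  have h1 := congrArg (fun x : ℂ × V × ℂ => x.2.1) (LinearMap.congr_fun h (1, 0, 0))
  simpa [truncatedAction_apply] using h1.symm

theorem nontrivial_quantumSym : Nontrivial (QuantumSym q b) :=
  (truncatedRep (q := q) (b := b) (0 : V →ₗ[ℂ] V →ₗ[ℂ] ℂ) (by simp)).toRingHom.domain_nontrivial

/-- A product of two vectors sends (1, 0, 0) to (0, 0, φ(u, v)). This transports a relation of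
S_q(V) to vectors outside the basis, such as the translates of basis vectors under G. -/
theorem bilin_eq_of_symι_mul_eq (φ : V →ₗ[ℂ] V →ₗ[ℂ] Q)
    (hφ : ∀ i j, φ (b i) (b j) = q i j • φ (b j) (b i)) {u v u' v' : V} {c : ℂ}
    (h : symι q b u * symι q b v = c • (symι q b u' * symι q b v')) : φ u v = c • φ u' v' := by
  have h1 := congrArg (truncatedRep φ hφ) h
  simp only [map_mul, map_smul, truncatedRep_symι] at h1
  have h2 := congrArg (fun x : ℂ × V × Q => x.2.2) (LinearMap.congr_fun h1 (1, 0, 0))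
  simpa [truncatedAction_apply] using h2

end Detect

/-! ### Conditions on the parameter in `S_q(V) ⋊ G` -/

section Criterion

theorem groupIncl_single {G A : Type*} [Group G] [Ring A] [Algebra ℂ A] [MulSemiringAction G A]
    [SMulCommClass G ℂ A] (g : G) : groupIncl A G (MonoidAlgebra.of ℂ G g) = single g 1 := by
  simp [groupIncl]

theorem coeff_groupIncl {G A : Type*} [Group G] [Ring A] [Algebra ℂ A] [MulSemiringAction G A]
    [SMulCommClass G ℂ A] (x : MonoidAlgebra ℂ G) (g : G) :
    (groupIncl A G x).coeff g = algebraMap ℂ A (x.coeff g) := by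
  classical
  induction x using MonoidAlgebra.induction_linear with
  | zero => simp
  | add x y hx hy => simp [hx, hy]
  | single h c =>
    simp [groupIncl, Finsupp.single_apply, Algebra.algebraMap_eq_smul_one]

variable {n : ℕ} {G V : Type*} [Group G] [AddCommGroup V] [Module ℂ V]
  {q : Fin n → Fin n → ℂ} {b : Module.Basis (Fin n) ℂ V}

theorem isQuantumSkew_of_bilin (hq : IsQuantumTuple q)
    (f κ : V →ₗ[ℂ] V →ₗ[ℂ] MonoidAlgebra ℂ G)
    (hf : ∀ i j, κ (b i) (b j) = f (b i) (b j) - q i j • f (b j) (b i)) :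
    IsQuantumSkew q b κ := by
  intro i j
  have h : q i j * q j i = 1 := by rw [hq.inv i j, mul_inv_cancel₀ (hq.ne_zero i j)]
  rw [hf, hf, smul_sub, smul_smul, h, one_smul, neg_sub]

variable
  [MulSemiringAction G (QuantumSym q b)] [SMulCommClass G ℂ (QuantumSym q b)]

theorem groupIncl_injective : Function.Injective (groupIncl (QuantumSym q b) G) := by
  have := nontrivial_quantumSym (q := q) (b := b)
  intro x y h
  ext g
  have h1 := congrArg (fun z => z.coeff g) h
  simp only [coeff_groupIncl] at h1
  exact (algebraMap ℂ (QuantumSym q b)).injective h1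

theorem exists_groupIncl_eq {x : Skew (QuantumSym q b) G} (hx : x ∈ skewPart G (symι q b) 0) :
    ∃ y, groupIncl _ G y = x := by
  have h : ∀ g, ∃ c : ℂ, algebraMap ℂ (QuantumSym q b) c = x.coeff g := by
    intro g
    have h := hx g
    rw [degPart, pow_zero, Submodule.mem_one] at h
    exact h
  choose c hc using h
  refine ⟨∑ g ∈ x.support, c g • MonoidAlgebra.of ℂ G g, ?_⟩
  rw [_root_.map_sum]
  conv_rhs => rw [← sum_single x, sum_def']
  refine Finset.sum_congr rfl fun g _ => ?_
  rw [map_smul, groupIncl_single, SkewMonoidAlgebra.smul_single, ← hc,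
    Algebra.algebraMap_eq_smul_one]

variable [DistribMulAction G V] [ExtendsAction G (symι q b)]

theorem symι_smul_mul_symι_smul (g : G) (i j : Fin n) :
    symι q b (g • b i) * symι q b (g • b j) =
      q i j • (symι q b (g • b j) * symι q b (g • b i)) := by
  simp only [← ExtendsAction.smul_ι, ← smul_mul']
  rw [symι_mul_symι, smul_comm]

variable [SMulCommClass G ℂ V]

theorem coeff_skewSymMk (y : Skew (TensorAlgebra ℂ V) G) (g : G) :
    (skewSymMk G q b y).coeff g = symMk q b (y.coeff g) := by
  classical
  induction y using SkewMonoidAlgebra.induction_on with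
  | zero => simp
  | single h a =>
    rw [skewSymMk_single, coeff_single_apply, coeff_single_apply]
    split_ifs <;> simp
  | add x y hx hy => simp [hx, hy]

/-- In degree one the coefficients lie in V, which embeds in S_q(V). -/
theorem eq_zero_of_skewSymMk_eq_zero {y : Skew (TensorAlgebra ℂ V) G}
    (hy : y ∈ skewPart G (TensorAlgebra.ι ℂ : V →ₗ[ℂ] TensorAlgebra ℂ V) 1)
    (h : skewSymMk G q b y = 0) : y = 0 := by
  ext g
  have h1 := hy g
  rw [degPart, pow_one] at h1
  obtain ⟨v, hv⟩ := h1
  have h2 := coeff_skewSymMk (q := q) (b := b) y g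
  rw [h, ← hv] at h2
  have h3 : symι q b v = symι q b 0 := by rw [map_zero]; exact h2.symm
  rw [← hv, symι_injective h3, map_zero]
  rfl

/-- The Jacobi expression has degree one, where passing from T(V) ⋊ G to S_q(V) ⋊ G loses nothing.
-/
theorem jacobi_tensor_eq_zero (κ : V →ₗ[ℂ] V →ₗ[ℂ] MonoidAlgebra ℂ G) {i j k : Fin n}
    (h : jacobi (symι q b) q b κ i j k = 0) : jacobi (TensorAlgebra.ι ℂ) q b κ i j k = 0 := by
  refine eq_zero_of_skewSymMk_eq_zero (q := q) (b := b) ?_ (Eq.trans ?_ h)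
  · have hv : ∀ i, algIncl (TensorAlgebra ℂ V) G (TensorAlgebra.ι ℂ (b i)) ∈
        skewPart G (TensorAlgebra.ι ℂ : V →ₗ[ℂ] TensorAlgebra ℂ V) 1 := fun i =>
      single_mem_skewPart _ 1 (by rw [degPart, pow_one]; exact ⟨_, rfl⟩)
    have hr : ∀ i j k, groupIncl (TensorAlgebra ℂ V) G (κ (b i) (b j)) *
        algIncl (TensorAlgebra ℂ V) G (TensorAlgebra.ι ℂ (b k)) ∈
        skewPart G (TensorAlgebra.ι ℂ : V →ₗ[ℂ] TensorAlgebra ℂ V) 1 := fun i j k => by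
      have h := skewPart_mul_mem _ (groupIncl_mem_skewPart (TensorAlgebra.ι ℂ) (κ (b i) (b j)))
        (hv k)
      rwa [zero_add] at h
    have hl : ∀ i j k, algIncl (TensorAlgebra ℂ V) G (TensorAlgebra.ι ℂ (b k)) *
        groupIncl (TensorAlgebra ℂ V) G (κ (b i) (b j)) ∈
        skewPart G (TensorAlgebra.ι ℂ : V →ₗ[ℂ] TensorAlgebra ℂ V) 1 := fun i j k => by
      have h := skewPart_mul_mem _ (hv k)
        (groupIncl_mem_skewPart (TensorAlgebra.ι ℂ) (κ (b i) (b j)))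
      rwa [add_zero] at h
    rw [jacobi]
    refine add_mem (sub_mem (sub_mem (add_mem (sub_mem (hr i j k) (hl j k i))
      ?_) ?_) ?_) ?_
    · exact Submodule.smul_mem _ _ (hl i k j)
    · exact Submodule.smul_mem _ _ (hr i k j)
    · exact Submodule.smul_mem _ _ (hl i j k)
    · exact Submodule.smul_mem _ _ (hr j k i)
  · simp only [jacobi, map_add, map_sub, map_smul, map_mul, skewSymMk_groupIncl,
      skewSymMk_algIncl]
    rfl

theorem single_conj_vector_mul (h : G) (v w : V) :
    (single h 1 * algIncl (TensorAlgebra ℂ V) G (TensorAlgebra.ι ℂ v * TensorAlgebra.ι ℂ w) *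
      single h⁻¹ 1 : Skew (TensorAlgebra ℂ V) G) =
      algIncl (TensorAlgebra ℂ V) G (TensorAlgebra.ι ℂ (h • v) * TensorAlgebra.ι ℂ (h • w)) := by
  show single h 1 * single 1 _ * single h⁻¹ 1 = single 1 _
  rw [single_mul_single, single_mul_single, smul_mul', ExtendsAction.smul_ι, ExtendsAction.smul_ι]
  simp

/-- Modulo the span of the relations, ψ(v, w) = v w - f(v, w) respects the relations of S_q(V) on
the basis. The relation between h v_i and h v_j in S_q(V) therefore passes to ψ, and by `hinv` this
says that the conjugated relation lies in the span. Only the antisymmetrization of f has to be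
invariant, not f itself. -/
theorem invariantRelations_of_bilin (f κ : V →ₗ[ℂ] V →ₗ[ℂ] MonoidAlgebra ℂ G)
    (hf : ∀ i j, κ (b i) (b j) = f (b i) (b j) - q i j • f (b j) (b i))
    (hinv : ∀ (h : G) i j, f (h • b i) (h • b j) - q i j • f (h • b j) (h • b i) =
      MonoidAlgebra.of ℂ G h * κ (b i) (b j) * MonoidAlgebra.of ℂ G h⁻¹) :
    InvariantRelations q b κ := by
  intro h i j
  let N := Submodule.span ℂ (Set.range fun p : Fin n × Fin n => relElt q b κ p.1 p.2)
  let ψ : V →ₗ[ℂ] V →ₗ[ℂ] Skew (TensorAlgebra ℂ V) G :=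
    (((LinearMap.mul ℂ (TensorAlgebra ℂ V)).compl₁₂ (TensorAlgebra.ι ℂ)
      (TensorAlgebra.ι ℂ)).compr₂ (algIncl (TensorAlgebra ℂ V) G).toLinearMap) -
      f.compr₂ (groupIncl (TensorAlgebra ℂ V) G).toLinearMap
  have hψ : ∀ v w, ψ v w = algIncl (TensorAlgebra ℂ V) G
      (TensorAlgebra.ι ℂ v * TensorAlgebra.ι ℂ w) - groupIncl (TensorAlgebra ℂ V) G (f v w) :=
    fun v w => rfl
  have hrel : ∀ i j, ψ (b i) (b j) - q i j • ψ (b j) (b i) = relElt q b κ i j := by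
    intro i j
    simp only [hψ, relElt, hf, map_sub, map_smul, smul_sub]
    abel
  have hmk : ∀ (c : ℂ) x y, N.mkQ x - c • N.mkQ y = N.mkQ (x - c • y) := fun c x y => by
    rw [map_sub, map_smul]
  have key := bilin_eq_of_symι_mul_eq (q := q) (b := b) (ψ.compr₂ N.mkQ) (fun i j => by
    show N.mkQ _ = q i j • N.mkQ _
    rw [← sub_eq_zero, hmk, hrel]
    exact (Submodule.Quotient.mk_eq_zero N).2 (Submodule.subset_span ⟨(i, j), rfl⟩))
    (symι_smul_mul_symι_smul h i j)
  change N.mkQ _ = q i j • N.mkQ _ at key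
  rw [← sub_eq_zero, hmk] at key
  have hmem := (Submodule.Quotient.mk_eq_zero N).1 key
  convert hmem using 1
  have hg : groupIncl (TensorAlgebra ℂ V) G (f (h • b i) (h • b j)) -
      q i j • groupIncl (TensorAlgebra ℂ V) G (f (h • b j) (h • b i)) =
      single h 1 * groupIncl (TensorAlgebra ℂ V) G (κ (b i) (b j)) * single h⁻¹ 1 := by
    rw [← groupIncl_single h, ← groupIncl_single h⁻¹, ← map_mul, ← map_mul, ← hinv, map_sub,
      map_smul (groupIncl (TensorAlgebra ℂ V) G)]
  rw [relElt, mul_sub, sub_mul, ← hg, map_sub, map_smul (algIncl (TensorAlgebra ℂ V) G),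
    mul_sub, sub_mul, mul_smul_comm,
    smul_mul_assoc, single_conj_vector_mul, single_conj_vector_mul, hψ, hψ, smul_sub]
  abel

/-- A bilinear map whose quantum antisymmetrization is invariant and satisfies the Jacobi identities
defines a quantum Drinfeld Hecke algebra. -/
theorem isQuantumDrinfeldHecke_of_bilin (hq : IsQuantumTuple q)
    (f κ : V →ₗ[ℂ] V →ₗ[ℂ] MonoidAlgebra ℂ G)
    (hf : ∀ i j, κ (b i) (b j) = f (b i) (b j) - q i j • f (b j) (b i))
    (hinv : ∀ (h : G) i j, f (h • b i) (h • b j) - q i j • f (h • b j) (h • b i) =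
      MonoidAlgebra.of ℂ G h * κ (b i) (b j) * MonoidAlgebra.of ℂ G h⁻¹)
    (hjac : ∀ i j k, i < j → j < k → jacobi (symι q b) q b κ i j k = 0) :
    IsQuantumDrinfeldHecke q b κ :=
  isQuantumDrinfeldHecke_of_jacobi hq (isQuantumSkew_of_bilin hq f κ hf)
    (invariantRelations_of_bilin f κ hf hinv)
    fun i j k hij hjk => jacobi_tensor_eq_zero κ (hjac i j k hij hjk)

end Criterion

/-! ### Constant cocycles define quantum Drinfeld Hecke algebras -/

section Cocycles

variable {n : ℕ} {G V : Type*} [Group G] [AddCommGroup V] [Module ℂ V]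
  {q : Fin n → Fin n → ℂ} {b : Module.Basis (Fin n) ℂ V}

/-- The quantum antisymmetrization of a bilinear map. -/
def quantumAlt {Q : Type*} [AddCommGroup Q] [Module ℂ Q] (q : Fin n → Fin n → ℂ)
    (b : Module.Basis (Fin n) ℂ V) (f : V →ₗ[ℂ] V →ₗ[ℂ] Q) : V →ₗ[ℂ] V →ₗ[ℂ] Q :=
  b.constr ℂ fun i => b.constr ℂ fun j => f (b i) (b j) - q i j • f (b j) (b i)

theorem quantumAlt_basis {Q : Type*} [AddCommGroup Q] [Module ℂ Q] (f : V →ₗ[ℂ] V →ₗ[ℂ] Q)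
    (i j : Fin n) : quantumAlt q b f (b i) (b j) = f (b i) (b j) - q i j • f (b j) (b i) := by
  rw [quantumAlt, Module.Basis.constr_basis, Module.Basis.constr_basis]

variable (q b) in
/-- The product `V × V → ⋀²_q(V)`. -/
def wedgeMul : V →ₗ[ℂ] V →ₗ[ℂ] ExtPow q b 2 :=
  LinearMap.mk₂ ℂ
    (fun v w => ⟨extι q b v * extι q b w, by
      rw [ExtPow, degPart, pow_two]
      exact Submodule.mul_mem_mul ⟨_, rfl⟩ ⟨_, rfl⟩⟩)
    (fun v v' w => Subtype.ext (by simp [add_mul])) (fun c v w => Subtype.ext (by simp))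
    (fun v w w' => Subtype.ext (by simp [mul_add])) (fun c v w => Subtype.ext (by simp))

theorem wedgeMul_basis (i j : Fin n) : wedgeMul q b (b i) (b j) = wedge q b ![i, j] :=
  Subtype.ext (by simp [wedgeMul, wedge])

theorem wedgeMul_swap (i j : Fin n) :
    wedgeMul q b (b i) (b j) = -(q i j • wedgeMul q b (b j) (b i)) := by
  refine Subtype.ext ?_
  have h : extι q b (b i) * extι q b (b j) = (-q i j) • (extι q b (b j) * extι q b (b i)) := by
    have h := RingQuot.mkAlgHom_rel ℂ (ExtRel.rel (q := q) (b := b) i j)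
    rw [map_smul, map_mul, map_mul] at h
    exact h
  exact h.trans (neg_smul _ _)

theorem smul_wedgeMul [DistribMulAction G V] [MulSemiringAction G (QuantumExt q b)]
    [ExtendsAction G (extι q b)] (g : G) (v w : V) :
    g • (wedgeMul q b v w : QuantumExt q b) = wedgeMul q b (g • v) (g • w) := by
  show g • (extι q b v * extι q b w) = extι q b (g • v) * extι q b (g • w)
  rw [smul_mul', ExtendsAction.smul_ι, ExtendsAction.smul_ι]

variable [MulSemiringAction G (QuantumSym q b)] [SMulCommClass G ℂ (QuantumSym q b)]

/-- Composing with a linear left inverse of `groupIncl` keeps bilinearity, which pointwise choice of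
preimages would not give. -/
theorem exists_bilin_groupIncl_eq (β : V →ₗ[ℂ] V →ₗ[ℂ] Skew (QuantumSym q b) G)
    (hβ : ∀ v w, ∃ x, groupIncl _ G x = β v w) :
    ∃ f : V →ₗ[ℂ] V →ₗ[ℂ] MonoidAlgebra ℂ G, ∀ v w, groupIncl _ G (f v w) = β v w := by
  obtain ⟨l, hl⟩ := LinearMap.exists_leftInverse_of_injective
    (groupIncl (QuantumSym q b) G).toLinearMap (LinearMap.ker_eq_bot.2 groupIncl_injective)
  refine ⟨β.compr₂ l, fun v w => ?_⟩
  obtain ⟨x, hx⟩ := hβ v w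
  have h : l (groupIncl _ G x) = x := LinearMap.congr_fun hl x
  rw [LinearMap.compr₂_apply, ← hx, h]

theorem algIncl_symι_mem (v : V) :
    algIncl _ G (symι q b v) ∈ skewPart G (symι q b) 1 :=
  single_mem_skewPart _ 1 (by rw [degPart, pow_one]; exact ⟨_, rfl⟩)

theorem algIncl_symι_mul (i j : Fin n) :
    algIncl _ G (symι q b (b i)) * algIncl _ G (symι q b (b j)) =
      q i j • (algIncl _ G (symι q b (b j)) * algIncl _ G (symι q b (b i))) := by
  rw [← map_mul, symι_mul_symι, map_smul, map_mul]

/-- Since q_ii = 1, evaluating α ∘ d_3 on v_i ∧ v_j ∧ v_k gives exactly minus the Jacobi expression.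
-/
theorem jacobi_eq_zero_of_koszul {α : ExtPow q b 2 →ₗ[ℂ] Skew (QuantumSym q b) G}
    (hq : IsQuantumTuple q) (hα : IsKoszulCocycle q b α)
    {κ : V →ₗ[ℂ] V →ₗ[ℂ] MonoidAlgebra ℂ G}
    (hκ : ∀ i j, groupIncl _ G (κ (b i) (b j)) = α (wedge q b ![i, j]))
    {i j k : Fin n} (hij : i < j) (hjk : j < k) : jacobi (symι q b) q b κ i j k = 0 := by
  have h := hα ![i, j, k] (by
    rw [Fin.strictMono_iff_lt_succ]
    intro s
    fin_cases s
    · exact hij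
    · exact hjk)
  have hone : ∀ a w, koszulExtend α ((a ⊗ₜ 1) ⊗ₜ w) = algIncl (QuantumSym q b) G a * α w :=
    fun a w => by simpa using koszulExtend_tmul α a 1 w
  have w0 : ![i, j, k] ∘ Fin.succAbove 0 = ![j, k] := by ext s; fin_cases s <;> rfl
  have w1 : ![i, j, k] ∘ Fin.succAbove 1 = ![i, k] := by ext s; fin_cases s <;> rfl
  have w2 : ![i, j, k] ∘ Fin.succAbove 2 = ![i, j] := by ext s; fin_cases s <;> rfl
  have i0 : (Finset.Iic (0 : Fin 3)) = {0} := by decide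
  have i1 : (Finset.Iic (1 : Fin 3)) = {0, 1} := by decide
  have i2 : (Finset.Iic (2 : Fin 3)) = {0, 1, 2} := by decide
  have j0 : (Finset.Ici (0 : Fin 3)) = {0, 1, 2} := by decide
  have j1 : (Finset.Ici (1 : Fin 3)) = {1, 2} := by decide
  have j2 : (Finset.Ici (2 : Fin 3)) = {2} := by decide
  rw [koszulD, Fin.sum_univ_three, w0, w1, w2, i0, i1, i2, j0, j1, j2] at h
  simp [TensorProduct.sub_tmul, ← TensorProduct.smul_tmul', koszulExtend_tmul,
    hone, ← hκ, hq.diag] at h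
  rw [jacobi, ← neg_eq_zero, ← h]
  module

variable {μ : Skew (QuantumSym q b) G →ₗ[ℂ] Skew (QuantumSym q b) G →ₗ[ℂ] Skew (QuantumSym q b) G}

/-- The Jacobi expression is the sum of the cocycle identity over the six orderings, each weighted
by its sign and by the q's of its inversions. The terms μ(x, y z) and μ(x y, z) then cancel in pairs
by quantum commutation. -/
theorem IsConstantCocycle.jacobi_eq_zero (hμ : IsConstantCocycle q b μ)
    {κ : V →ₗ[ℂ] V →ₗ[ℂ] MonoidAlgebra ℂ G}
    (hκ : ∀ i j, groupIncl _ G (κ (b i) (b j)) =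
      μ (algIncl _ G (symι q b (b i))) (algIncl _ G (symι q b (b j)))
        - q i j • μ (algIncl _ G (symι q b (b j))) (algIncl _ G (symι q b (b i))))
    (i j k : Fin n) : jacobi (symι q b) q b κ i j k = 0 := by
  set x : Fin n → Skew (QuantumSym q b) G := fun i => algIncl _ G (symι q b (b i)) with hx
  have c : ∀ i j k, μ (x i) (x j) * x k - x i * μ (x j) (x k) =
      μ (x i) (x j * x k) - μ (x i * x j) (x k) := by
    intro i j k
    rw [sub_eq_sub_iff_add_eq_add, hμ.cocycle]
  have hxx : ∀ i j, x i * x j = q i j • (x j * x i) := algIncl_symι_mul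
  have r : ∀ i j k, μ (x k) (x i * x j) = q i j • μ (x k) (x j * x i) := fun i j k => by
    rw [hxx, map_smul]
  have l : ∀ i j k, μ (x i * x j) (x k) = q i j • μ (x j * x i) (x k) := fun i j k => by
    rw [hxx, map_smul, LinearMap.smul_apply]
  have key : jacobi (symι q b) q b κ i j k =
      (μ (x i) (x j) * x k - x i * μ (x j) (x k))
      - q i j • (μ (x j) (x i) * x k - x j * μ (x i) (x k))
      - q j k • (μ (x i) (x k) * x j - x i * μ (x k) (x j))
      + (q i j * q i k) • (μ (x j) (x k) * x i - x j * μ (x k) (x i))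
      + (q j k * q i k) • (μ (x k) (x i) * x j - x k * μ (x i) (x j))
      - (q i j * q i k * q j k) • (μ (x k) (x j) * x i - x k * μ (x j) (x i)) := by
    rw [jacobi]
    simp only [hκ]
    change (μ (x i) (x j) - q i j • μ (x j) (x i)) * x k
      - x i * (μ (x j) (x k) - q j k • μ (x k) (x j))
      + q i j • (x j * (μ (x i) (x k) - q i k • μ (x k) (x i)))
      - q j k • ((μ (x i) (x k) - q i k • μ (x k) (x i)) * x j)
      - (q j k * q i k) • (x k * (μ (x i) (x j) - q i j • μ (x j) (x i)))
      + (q i j * q i k) • ((μ (x j) (x k) - q j k • μ (x k) (x j)) * x i) = _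
    simp only [mul_sub, sub_mul, mul_smul_comm, smul_mul_assoc]
    module
  rw [key, c, c, c, c, c, c, r i j k, r i k j, r j k i, l i j k, l i k j, l j k i]
  module

variable [DistribMulAction G V] [ExtendsAction G (symι q b)]

theorem single_mul_algIncl_symι (g : G) (v : V) :
    (single g 1 * algIncl _ G (symι q b v) : Skew (QuantumSym q b) G) =
      algIncl _ G (symι q b (g • v)) * single g 1 := by
  show single g 1 * single 1 _ = single 1 _ * single g 1
  rw [single_mul_single, single_mul_single, ExtendsAction.smul_ι]
  simp

/-- Degree -2 kills μ on a group element and a vector. The cocycle identities for (g, v, w), (gv, g,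
w) and (gv, gw, g) then combine; the terms with a product of two vectors measure how far μ is from
invariant on V × V. -/
theorem IsConstantCocycle.apply_smul (hμ : IsConstantCocycle q b μ) (g : G) (v w : V) :
    μ (algIncl _ G (symι q b (g • v))) (algIncl _ G (symι q b (g • w))) * single g 1
      + μ (algIncl _ G (symι q b (g • v)) * algIncl _ G (symι q b (g • w))) (single g 1) =
    μ (single g 1) (algIncl _ G (symι q b v) * algIncl _ G (symι q b w))
      + single g 1 * μ (algIncl _ G (symι q b v)) (algIncl _ G (symι q b w)) := by
  have hg : (single g 1 : Skew (QuantumSym q b) G) ∈ skewPart G (symι q b) 0 :=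
    single_mem_skewPart _ g (one_mem_degPart _)
  have z1 : ∀ v, μ (single g 1) (algIncl _ G (symι q b v)) = 0 := fun v =>
    (hμ.degree 0 1 _ hg _ (algIncl_symι_mem v)).1 (by norm_num)
  have z2 : ∀ v, μ (algIncl _ G (symι q b v)) (single g 1) = 0 := fun v =>
    (hμ.degree 1 0 _ (algIncl_symι_mem v) _ hg).1 (by norm_num)
  have c1 := hμ.cocycle (single g 1) (algIncl _ G (symι q b v)) (algIncl _ G (symι q b w))
  have c2 := hμ.cocycle (algIncl _ G (symι q b (g • v))) (single g 1) (algIncl _ G (symι q b w))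
  have c3 := hμ.cocycle (algIncl _ G (symι q b (g • v))) (algIncl _ G (symι q b (g • w)))
    (single g 1)
  rw [z1, zero_mul, zero_add, single_mul_algIncl_symι] at c1
  rw [z2, z1, zero_mul, zero_add, mul_zero, add_zero, single_mul_algIncl_symι] at c2
  rw [z2, mul_zero, add_zero, ← c2] at c3
  rw [c3, c1]

/-- The error terms of `apply_smul` depend only on products in S_q(V), and these quantum commute,
also after applying g. They therefore cancel in the antisymmetrization. -/
theorem IsConstantCocycle.apply_smul_sub (hμ : IsConstantCocycle q b μ) (g : G) (i j : Fin n) :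
    μ (algIncl _ G (symι q b (g • b i))) (algIncl _ G (symι q b (g • b j)))
      - q i j • μ (algIncl _ G (symι q b (g • b j))) (algIncl _ G (symι q b (g • b i))) =
    single g 1 * (μ (algIncl _ G (symι q b (b i))) (algIncl _ G (symι q b (b j)))
      - q i j • μ (algIncl _ G (symι q b (b j))) (algIncl _ G (symι q b (b i)))) *
      single g⁻¹ 1 := by
  have h1 := hμ.apply_smul g (b i) (b j)
  have h2 := congrArg (q i j • ·) (hμ.apply_smul g (b j) (b i))
  simp only [smul_add] at h2
  have e : algIncl _ G (symι q b (g • b i)) * algIncl _ G (symι q b (g • b j)) =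
      q i j • (algIncl _ G (symι q b (g • b j)) * algIncl _ G (symι q b (g • b i))) := by
    rw [← map_mul, symι_smul_mul_symι_smul, map_smul, map_mul]
  rw [e, algIncl_symι_mul, map_smul μ, LinearMap.smul_apply, map_smul (μ (single g 1))] at h1
  have h3 : (μ (algIncl _ G (symι q b (g • b i))) (algIncl _ G (symι q b (g • b j)))
      - q i j • μ (algIncl _ G (symι q b (g • b j))) (algIncl _ G (symι q b (g • b i)))) *
        single g 1 =
      single g 1 * (μ (algIncl _ G (symι q b (b i))) (algIncl _ G (symι q b (b j)))
      - q i j • μ (algIncl _ G (symι q b (b j))) (algIncl _ G (symι q b (b i)))) := by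
    rw [sub_mul, mul_sub, smul_mul_assoc, mul_smul_comm]
    have cancel : ∀ x x' y y' p r : Skew (QuantumSym q b) G, x + p = r + y → x' + p = r + y' →
        x - x' = y - y' := fun x x' y y' p r h h' => by
      rw [← add_sub_add_right_eq_sub x x' p, h, h', add_sub_add_left_eq_sub]
    exact cancel _ _ _ _ _ _ h1 h2
  rw [← h3, mul_assoc, single_mul_single, mul_inv_cancel, smul_one, mul_one, single_one_one,
    mul_one]

end Cocycles

end

end QDHA

/-! ### ### Both descriptions of constant cocycles -/

open QDHA in
theorem theorem4p3 {n : ℕ} {G V : Type*} [Group G] [Finite G] [AddCommGroup V] [Module ℂ V]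
    [DistribMulAction G V] [SMulCommClass G ℂ V]
    (q : Fin n → Fin n → ℂ) (hq : IsQuantumTuple q) (b : Module.Basis (Fin n) ℂ V)
    [MulSemiringAction G (QuantumSym q b)] [SMulCommClass G ℂ (QuantumSym q b)]
    [ExtendsAction G (symι q b)]
    [MulSemiringAction G (QuantumExt q b)] [SMulCommClass G ℂ (QuantumExt q b)]
    [ExtendsAction G (extι q b)] :
    (∀ μ : Skew (QuantumSym q b) G →ₗ[ℂ] Skew (QuantumSym q b) G →ₗ[ℂ] Skew (QuantumSym q b) G,
      IsConstantCocycle q b μ →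
      ∃ κ : V →ₗ[ℂ] V →ₗ[ℂ] MonoidAlgebra ℂ G,
        (∀ i j, groupIncl (QuantumSym q b) G (κ (b i) (b j)) =
          μ (algIncl _ G (symι q b (b i))) (algIncl _ G (symι q b (b j)))
            - q i j • μ (algIncl _ G (symι q b (b j))) (algIncl _ G (symι q b (b i)))) ∧
        IsQuantumSkew q b κ ∧ IsQuantumDrinfeldHecke q b κ) ∧
    (∀ α : ExtPow q b 2 →ₗ[ℂ] Skew (QuantumSym q b) G,
      IsConstantKoszulCocycle q b α →
      ∃ κ : V →ₗ[ℂ] V →ₗ[ℂ] MonoidAlgebra ℂ G,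
        (∀ i j, groupIncl (QuantumSym q b) G (κ (b i) (b j)) = α (wedge q b ![i, j])) ∧
        IsQuantumSkew q b κ ∧ IsQuantumDrinfeldHecke q b κ) := by
  refine ⟨fun μ hμ => ?_, fun α hα => ?_⟩
  -- On two vectors μ has degree 1 + 1 - 2 = 0, so its values lie in ℂG.
  · obtain ⟨f, hf⟩ := exists_bilin_groupIncl_eq
      (μ.compl₁₂ ((algIncl _ G).toLinearMap.comp (symι q b))
        ((algIncl _ G).toLinearMap.comp (symι q b)))
      (fun v w => exists_groupIncl_eq
        ((hμ.degree 1 1 _ (algIncl_symι_mem v) _ (algIncl_symι_mem w)).2 le_rfl))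
    have hf' : ∀ v w, groupIncl (QuantumSym q b) G (f v w) =
        μ (algIncl _ G (symι q b v)) (algIncl _ G (symι q b w)) := hf
    have hκ : ∀ i j, groupIncl (QuantumSym q b) G (quantumAlt q b f (b i) (b j)) =
        μ (algIncl _ G (symι q b (b i))) (algIncl _ G (symι q b (b j)))
          - q i j • μ (algIncl _ G (symι q b (b j))) (algIncl _ G (symι q b (b i))) := by
      intro i j
      rw [quantumAlt_basis, map_sub, map_smul, hf', hf']
    refine ⟨quantumAlt q b f, hκ, isQuantumSkew_of_bilin hq f _ (quantumAlt_basis f),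
      isQuantumDrinfeldHecke_of_bilin hq f _ (quantumAlt_basis f) (fun h i j => ?_)
        fun i j k _ _ => hμ.jacobi_eq_zero hκ i j k⟩
    apply groupIncl_injective (q := q) (b := b)
    rw [map_sub, map_smul (groupIncl (QuantumSym q b) G), hf', hf', map_mul, map_mul,
      groupIncl_single, groupIncl_single, hκ, hμ.apply_smul_sub]
  · obtain ⟨κ, hκ⟩ := exists_bilin_groupIncl_eq ((wedgeMul q b).compr₂ α)
      (fun v w => hα.constant _)
    have hκ' : ∀ v w, groupIncl (QuantumSym q b) G (κ v w) = α (wedgeMul q b v w) := hκ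
    have hκb : ∀ i j, groupIncl (QuantumSym q b) G (κ (b i) (b j)) = α (wedge q b ![i, j]) :=
      fun i j => by rw [hκ', wedgeMul_basis]
    have hskew : IsQuantumSkew q b κ := by
      intro i j
      apply groupIncl_injective (q := q) (b := b)
      rw [map_neg, map_smul, hκ', hκ', wedgeMul_swap, map_neg, map_smul]
    have hinv : ∀ (h : G) v w, κ (h • v) (h • w) =
        MonoidAlgebra.of ℂ G h * κ v w * MonoidAlgebra.of ℂ G h⁻¹ := by
      intro h v w
      apply groupIncl_injective (q := q) (b := b)
      rw [map_mul, map_mul, groupIncl_single, groupIncl_single, hκ', hκ', ← hα.invariant]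
      congr 1
      exact Subtype.ext (smul_wedgeMul h v w).symm
    -- For a quantum skew κ, antisymmetrization is multiplication by 2, so κ is the
    -- antisymmetrization of κ/2 and the bilinear criterion applies.
    have hhalf : ∀ i j, κ (b i) (b j) = ((1 / 2 : ℂ) • κ) (b i) (b j)
        - q i j • ((1 / 2 : ℂ) • κ) (b j) (b i) := by
      intro i j
      have h := hskew i j
      rw [eq_neg_iff_add_eq_zero, add_eq_zero_iff_eq_neg'] at h
      simp only [LinearMap.smul_apply]
      rw [smul_comm, h]
      module
    refine ⟨κ, hκb, hskew, isQuantumDrinfeldHecke_of_bilin hq ((1 / 2 : ℂ) • κ) κ hhalf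
      (fun h i j => ?_) fun i j k hij hjk => jacobi_eq_zero_of_koszul hq hα.cocycle hκb hij hjk⟩
    rw [hhalf i j]
    simp only [LinearMap.smul_apply, hinv, mul_sub, sub_mul, mul_smul_comm, smul_mul_assoc]
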